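/- Let $D=I\times J$ be an open rectangle in the $xy$-plane ($I,J$ nonempty open intervals, possibly unbounded), and let $A,B:D\to\mathbb R$ be smooth with $A>B$, $A_y\neq0$ and $B_x\neq 0$ at every point of $D$. Let $S=A\,\partial_x\otimes dx+B\,\partial_y\otimes dy$. A normally oriented immersion realizing $S$ is a smooth immersion $\mathbf x:D\to\mathbb E^3$ with a smooth unit normal $\mathbf n:D\to S^2$ whose fundamental forms $\mathrm I=d\mathbf x\cdot d\mathbf x$ and $\mathrm{II}=-d\mathbf n\cdot d\mathbf x$ satisfy $\mathrm{II}(v,w)=\mathrm I(v,Sw)=\mathrm I(Sv,w)$. Two of them are congruent if an isometry of $\mathbb E^3$ carries $\mathbf x$ to $\mathbf x'$ and its linear part carries $\mathbf n$ to $\mathbf n'$. Let $\mathcal X(S)$ be the set of congruence classes. For a realization put $a=1/|\mathbf x_x|^2$ and $b=1/|\mathbf x_y|^2$ (so that $\mathrm I=dx^2/a+dy^2/b$), and $$p=B_x a_x+2\Bigl(B_{xx}+\frac{B_x(2B_x-A_x)}{A-B}\Bigr)a-AB(B-A).$$ Consider the following inhomogeneous linear total differential system for three smooth functions $(a,b,p)$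 on $D$: $$a_y=\frac{2A_y}{A-B}\,a,\qquad b_x=\frac{2B_x}{B-A}\,b,$$ $$a_x=\frac{p}{B_x}-2\Bigl(\frac{B_{xx}}{B_x}+\frac{2B_x-A_x}{A-B}\Bigr)a+\frac{AB(B-A)}{B_x},\qquad b_y=\frac{p}{A_y}-2\Bigl(\frac{A_{yy}}{A_y}+\frac{2A_y-B_y}{B-A}\Bigr)b+\frac{AB(A-B)}{A_y},$$ $$\begin{aligned}p_y={}&\Bigl(\frac{B_{xy}}{B_x}+\frac{2A_y}{A-B}\Bigr)p+2\Bigl(B_{xxy}-\frac{B_{xx}B_{xy}}{B_x}+\frac{2B_xB_{xy}}{A-B}-\frac{B_x(A_yB_x+A_xB_y-2B_xB_y)}{(A-B)^2}\Bigr)a\\&-\frac{AB(A-B)B_{xy}}{B_x}+A^2B_y-2ABB_y-B^2A_y,\end{aligned}$$ $$\begin{aligned}p_x={}&\Bigl(\frac{A_{xy}}{A_y}+\frac{2B_x}{B-A}\Bigr)p+2\Bigl(A_{xyy}-\frac{A_{yy}A_{xy}}{A_y}+\frac{2A_yA_{xy}}{B-A}-\frac{A_y(B_xA_y+B_yA_x-2A_xA_y)}{(B-A)^2}\Bigr)b\\&-\frac{AB(B-A)A_{xy}}{A_y}+B^2A_x-2ABA_x-A^2B_x.\end{aligned}$$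 Then: (1) For every realization, $(a,b,p)$ solves the system. The map $\Psi:\mathcal X(S)\to\{\text{pairs of functions on }D\}$, $[(\mathbf x,\mathbf n)]\mapsto(a,b)$, is well defined and injective; its image is convex and consists exactly of the pairs $(a,b)$ with $a,b>0$ on $D$ for which $(a,b,p)$ solves the system for some $p$. (2) A solution $(a,b,p)$ of the system on $D$ is determined by its value at any single point of $D$. (3) For every $q_0\in D$ the map $\Phi:\mathcal X(S)\to\mathbb R^3$, $[(\mathbf x,\mathbf n)]\mapsto(a(q_0),b(q_0),p(q_0))$, is well defined and injective, and its image is convex; moreover, for $c_0,c_1\in\mathcal X(S)$ and $0\le t\le1$ there is a class $c\in\mathcal X(S)$ with $\Psi(c)=(1-t)\Psi(c_0)+t\Psi(c_1)$ and $\Phi(c)=(1-t)\Phi(c_0)+t\Phi(c_1)$. In this sense the space of Euclidean congruence classes of normally oriented immersions realizing $S$ is naturally a convex set in a vector space of dimension $3$. -/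

import Mathlib

open scoped ContDiff

namespace ShapeOperator

/-- Euclidean 3-space. -/
abbrev E3 : Type := EuclideanSpace ℝ (Fin 3)

/-- Partial derivative in the first coordinate `x` of the `xy`-plane. -/
noncomputable def pdx {F : Type*} [NormedAddCommGroup F] [NormedSpace ℝ F]
    (f : ℝ × ℝ → F) (q : ℝ × ℝ) : F :=
  fderiv ℝ f q (1, 0)

/-- Partial derivative in the second coordinate `y` of the `xy`-plane. -/
noncomputable def pdy {F : Type*} [NormedAddCommGroup F] [NormedSpace ℝ F]
    (f : ℝ × ℝ → F) (q : ℝ × ℝ) : F :=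
  fderiv ℝ f q (0, 1)

/-- First fundamental form `I = dx · dx` of a map `X` into Euclidean space. -/
noncomputable def firstForm (X : ℝ × ℝ → E3) (q v w : ℝ × ℝ) : ℝ :=
  inner ℝ (fderiv ℝ X q v) (fderiv ℝ X q w)

/-- Second fundamental form `II = - dn · dx` of a map `X` with unit normal `N`. -/
noncomputable def secondForm (X N : ℝ × ℝ → E3) (q v w : ℝ × ℝ) : ℝ :=
  -inner ℝ (fderiv ℝ N q v) (fderiv ℝ X q w)

/-- The endomorphism field `S = A ∂/∂x ⊗ dx + B ∂/∂y ⊗ dy`. -/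
def diagOp (A B : ℝ × ℝ → ℝ) (q v : ℝ × ℝ) : ℝ × ℝ :=
  (A q * v.1, B q * v.2)

/-- A smooth normally oriented immersion `(X, N)` of the planar domain `D` into Euclidean
3-space whose shape operator is `A ∂/∂x ⊗ dx + B ∂/∂y ⊗ dy`. Only the values of `X` and `N` on
`D` matter; the congruence relation below disregards all other values. -/
structure Realization (D : Set (ℝ × ℝ)) (A B : ℝ × ℝ → ℝ) where
  /-- the immersion -/
  X : ℝ × ℝ → E3
  /-- the unit normal -/
  N : ℝ × ℝ → E3
  smooth_X : ContDiffOn ℝ ∞ X D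
  smooth_N : ContDiffOn ℝ ∞ N D
  immersion : ∀ q ∈ D, Function.Injective (fderiv ℝ X q)
  unit_normal : ∀ q ∈ D, ‖N q‖ = 1
  orthogonal : ∀ q ∈ D, ∀ v, inner ℝ (N q) (fderiv ℝ X q v) = 0
  shape_right : ∀ q ∈ D, ∀ v w, secondForm X N q v w = firstForm X q v (diagOp A B q w)
  shape_left : ∀ q ∈ D, ∀ v w, secondForm X N q v w = firstForm X q (diagOp A B q v) w

namespace Realization

variable {D : Set (ℝ × ℝ)} {A B : ℝ × ℝ → ℝ}

/-- Euclidean congruence: an isometry of 3-space carries one immersion to the other, and its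
linear part carries the unit normal to the unit normal. -/
def Congruent (r s : Realization D A B) : Prop :=
  ∃ φ : E3 ≃ᵃⁱ[ℝ] E3, ∀ q ∈ D, s.X q = φ (r.X q) ∧ s.N q = φ.linearIsometryEquiv (r.N q)

theorem congruent_equivalence : Equivalence (Congruent (D := D) (A := A) (B := B)) where
  refl r := ⟨AffineIsometryEquiv.refl ℝ E3, fun _ _ => ⟨rfl, rfl⟩⟩
  symm := by
    rintro r s ⟨φ, h⟩
    refine ⟨φ.symm, fun q hq => ⟨?_, ?_⟩⟩
    · rw [(h q hq).1, AffineIsometryEquiv.symm_apply_apply]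
    · rw [(h q hq).2]
      exact (φ.linearIsometryEquiv.symm_apply_apply (r.N q)).symm
  trans := by
    rintro r s t ⟨φ, h⟩ ⟨ψ, k⟩
    refine ⟨φ.trans ψ, fun q hq => ⟨?_, ?_⟩⟩
    · rw [(k q hq).1, (h q hq).1]; rfl
    · rw [(k q hq).2, (h q hq).2]; rfl

instance congruenceSetoid (D : Set (ℝ × ℝ)) (A B : ℝ × ℝ → ℝ) : Setoid (Realization D A B) :=
  ⟨Congruent, congruent_equivalence⟩

/-- The function `a > 0` in `I = dx² / a + dy² / b`. -/
noncomputable def a (r : Realization D A B) (q : ℝ × ℝ) : ℝ :=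
  (firstForm r.X q (1, 0) (1, 0))⁻¹

/-- The function `b > 0` in `I = dx² / a + dy² / b`. -/
noncomputable def b (r : Realization D A B) (q : ℝ × ℝ) : ℝ :=
  (firstForm r.X q (0, 1) (0, 1))⁻¹

/-- The function `p`: the value that the equation for `a_x` in the total differential system
forces on the third unknown. -/
noncomputable def p (r : Realization D A B) (q : ℝ × ℝ) : ℝ :=
  pdx B q * pdx r.a q
    + 2 * (pdx (pdx B) q + pdx B q * (2 * pdx B q - pdx A q) / (A q - B q)) * r.a q
    - A q * B q * (B q - A q)

end Realization

/-- The space of Euclidean congruence classes of normally oriented immersions of `D` with shape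
operator `A ∂/∂x ⊗ dx + B ∂/∂y ⊗ dy`. -/
def CongruenceClass (D : Set (ℝ × ℝ)) (A B : ℝ × ℝ → ℝ) : Type :=
  Quotient (Realization.congruenceSetoid D A B)

/-- The congruence class of a realization. -/
def Realization.toClass {D : Set (ℝ × ℝ)} {A B : ℝ × ℝ → ℝ} (r : Realization D A B) :
    CongruenceClass D A B :=
  Quotient.mk (Realization.congruenceSetoid D A B) r

/-- `(a, b, p)` is a smooth solution on `D` of the inhomogeneous linear total differential system
attached to `(A, B)`: all first partial derivatives of the three unknowns are prescribed. -/
structure IsTotalSolution (D : Set (ℝ × ℝ)) (A B a b p : ℝ × ℝ → ℝ) : Prop where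
  smooth_a : ContDiffOn ℝ ∞ a D
  smooth_b : ContDiffOn ℝ ∞ b D
  smooth_p : ContDiffOn ℝ ∞ p D
  eq_a_y : ∀ q ∈ D, pdy a q = 2 * pdy A q / (A q - B q) * a q
  eq_b_x : ∀ q ∈ D, pdx b q = 2 * pdx B q / (B q - A q) * b q
  eq_a_x : ∀ q ∈ D, pdx a q = 1 / pdx B q * p q
    - 2 * (pdx (pdx B) q / pdx B q + (2 * pdx B q - pdx A q) / (A q - B q)) * a q
    + A q * B q * (B q - A q) / pdx B q
  eq_b_y : ∀ q ∈ D, pdy b q = 1 / pdy A q * p q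
    - 2 * (pdy (pdy A) q / pdy A q + (2 * pdy A q - pdy B q) / (B q - A q)) * b q
    + A q * B q * (A q - B q) / pdy A q
  eq_p_y : ∀ q ∈ D, pdy p q =
    (pdy (pdx B) q / pdx B q + 2 * pdy A q / (A q - B q)) * p q
    + 2 * (pdy (pdx (pdx B)) q - pdx (pdx B) q * pdy (pdx B) q / pdx B q
        + 2 * pdx B q * pdy (pdx B) q / (A q - B q)
        - pdx B q * (pdy A q * pdx B q + pdx A q * pdy B q - 2 * pdx B q * pdy B q)
          / (A q - B q) ^ 2) * a q
    - A q * B q * (A q - B q) * pdy (pdx B) q / pdx B q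
    + A q ^ 2 * pdy B q - 2 * A q * B q * pdy B q - B q ^ 2 * pdy A q
  eq_p_x : ∀ q ∈ D, pdx p q =
    (pdx (pdy A) q / pdy A q + 2 * pdx B q / (B q - A q)) * p q
    + 2 * (pdx (pdy (pdy A)) q - pdy (pdy A) q * pdx (pdy A) q / pdy A q
        + 2 * pdy A q * pdx (pdy A) q / (B q - A q)
        - pdy A q * (pdx B q * pdy A q + pdy B q * pdx A q - 2 * pdy A q * pdx A q)
          / (B q - A q) ^ 2) * b q
    - A q * B q * (B q - A q) * pdx (pdy A) q / pdy A q
    + B q ^ 2 * pdx A q - 2 * A q * B q * pdx A q - A q ^ 2 * pdx B q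

end ShapeOperator

open ShapeOperator

/-! This is Bonnet's theorem together with the fact that, in the unknowns a = 1/|X_x|² and b =
1/|X_y|², the compatibility equations for a prescribed diagonal shape operator are affine.

Self-adjointness of S with distinct eigenvalues A, B makes the coordinate directions orthogonal, so
I = dx²/a + dy²/b. Comparing N_xy with N_yx (`pdy_pdx_X`) expresses X_xy through X_x and X_y. This
yields Codazzi's equations, which are homogeneous linear equations for a_y and b_x. Gauss's
equation, nonlinear in the metric coefficients, becomes after clearing denominators an affine
relation between (a, a_x) and (b, b_y) (`gauss`). The common value of its two sides, without the
zeroth order constants having been removed, is p. Solving for a_x and b_y requires B_x ≠ 0 and A_y ≠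
0. Differentiating p through a in the y-direction and through b in the x-direction closes the
system, so a realization gives a total solution (`isTotalSolution`).

Conversely, a positive solution makes the linear system for the tuple (X, X_x, X_y, N) flat
(`frame_flat`). A Frobenius theorem on the rectangle (`linearTotal_exists`) integrates it, and
orthogonality with the right lengths propagates from one point because a X_x⊗X_x + b X_y⊗X_y + N⊗N
is constant (`exists_realization`). Two realizations with the same a and b are congruent by
uniqueness for the same frame system (`congruent_of_a_eq_b_eq`).

Hence classes correspond to positive solutions. An affine combination of solutions is a solution,
and positivity survives for 0 ≤ t ≤ 1, which is the convexity. The difference of two solutions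
satisfies a homogeneous linear system in three unknowns, so its value at one point determines it
(`eq_of_eq_at`) and evaluation at a point embeds the classes in dimension 3. Only uniqueness is used
for the (a, b, p) system; its own flatness, hence the existence of a solution for every initial
value, plays no role. -/

namespace ShapeOperator

open Set Filter Topology Asymptotics

/-! ### Linear ordinary differential equations: Grönwall bounds, uniqueness, global existence. -/

section LinearODE

variable {V : Type*} [NormedAddCommGroup V] [NormedSpace ℝ V]

/-- From e^u - 1 ≤ u e^u. This replaces the two cases K = 0 and K ≠ 0 of `gronwallBound` by a single
expression, monotone in x ≥ 0 when δ, ε ≥ 0. -/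
theorem gronwallBound_le_mul_exp {δ K ε x : ℝ} (hK : 0 ≤ K) (hε : 0 ≤ ε) :
    gronwallBound δ K ε x ≤ (δ + ε * x) * Real.exp (K * x) := by
  rcases hK.eq_or_lt with rfl | hK
  · simp [gronwallBound_K0]
  · rw [gronwallBound_of_K_ne_0 hK.ne', add_mul]
    have h1 : Real.exp (K * x) - 1 ≤ K * x * Real.exp (K * x) := by
      have h := Real.add_one_le_exp (-(K * x))
      have h2 : Real.exp (-(K * x)) * Real.exp (K * x) = 1 := by
        rw [← Real.exp_add]; simp
      nlinarith [Real.exp_pos (K * x)]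
    have h2 : ε / K * (Real.exp (K * x) - 1) ≤ ε / K * (K * x * Real.exp (K * x)) :=
      mul_le_mul_of_nonneg_left h1 (by positivity)
    have h3 : ε / K * (K * x * Real.exp (K * x)) = ε * x * Real.exp (K * x) := by
      field_simp
    linarith

/-- Forward Grönwall estimate on a compact interval. -/
theorem norm_le_of_norm_deriv_le_right {f f' : ℝ → V} {K ε c d : ℝ} (hK : 0 ≤ K) (hε : 0 ≤ ε)
    (hf : ∀ t ∈ Icc c d, HasDerivWithinAt f (f' t) (Icc c d) t)
    (bound : ∀ t ∈ Icc c d, ‖f' t‖ ≤ K * ‖f t‖ + ε) :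
    ∀ t ∈ Icc c d, ‖f t‖ ≤ (‖f c‖ + ε * (t - c)) * Real.exp (K * (t - c)) := by
  intro t ht
  refine (norm_le_gronwallBound_of_norm_deriv_right_le (f' := f')
    (fun s hs => (hf s hs).continuousWithinAt) ?_ le_rfl
    (fun s hs => bound s (Ico_subset_Icc_self hs)) t ht).trans
      (gronwallBound_le_mul_exp hK hε)
  intro s hs
  exact (hf s (Ico_subset_Icc_self hs)).mono_of_mem_nhdsWithin
    (Icc_mem_nhdsGE_of_mem hs)

/-- Grönwall estimate on a compact interval, in both directions from an interior time. -/
theorem norm_le_of_norm_deriv_le {f f' : ℝ → V} {K ε c d t₀ : ℝ} (hK : 0 ≤ K) (hε : 0 ≤ ε)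
    (ht₀ : t₀ ∈ Icc c d)
    (hf : ∀ t ∈ Icc c d, HasDerivWithinAt f (f' t) (Icc c d) t)
    (bound : ∀ t ∈ Icc c d, ‖f' t‖ ≤ K * ‖f t‖ + ε) :
    ∀ t ∈ Icc c d, ‖f t‖ ≤ (‖f t₀‖ + ε * (d - c)) * Real.exp (K * (d - c)) := by
  have mono : ∀ s, 0 ≤ s → s ≤ d - c → (‖f t₀‖ + ε * s) * Real.exp (K * s)
      ≤ (‖f t₀‖ + ε * (d - c)) * Real.exp (K * (d - c)) := by
    intro s hs hs'
    gcongr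
    have := hs.trans hs'
    positivity
  intro t ht
  rcases le_total t₀ t with h | h
  · have hsub : Icc t₀ d ⊆ Icc c d := Icc_subset_Icc_left ht₀.1
    refine (norm_le_of_norm_deriv_le_right hK hε
      (fun s hs => (hf s (hsub hs)).mono hsub) (fun s hs => bound s (hsub hs)) t
      ⟨h, ht.2⟩).trans (mono _ (by linarith) (by linarith [ht₀.1, ht.2]))
  -- Before t₀, reverse time: s ↦ f(-s) satisfies the same differential inequality forward from -t₀.
  · have hsub : MapsTo (fun s : ℝ => -s) (Icc (-t₀) (-c)) (Icc c d) := by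
      intro s hs
      exact ⟨by linarith [hs.2], by linarith [hs.1, ht₀.2]⟩
    have key := norm_le_of_norm_deriv_le_right (f := fun s => f (-s)) (f' := fun s => -f' (-s))
      (c := -t₀) (d := -c) hK hε ?_ ?_ (-t) ⟨by linarith, by linarith [ht.1]⟩
    · simp only [neg_neg] at key
      exact key.trans (mono _ (by linarith) (by linarith [ht₀.2, ht.1]))
    · intro s hs
      have := (hf (-s) (hsub hs)).scomp s (hasDerivWithinAt_neg s (Icc (-t₀) (-c))) hsub
      simpa [Function.comp_def] using this
    · intro s hs
      simpa using bound (-s) (hsub hs)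

theorem exists_norm_le_of_continuousOn {X W : Type*} [TopologicalSpace X] [NormedAddCommGroup W]
    {S : Set X} (hS : IsCompact S) {g : X → W} (hg : ContinuousOn g S) :
    ∃ K, 0 ≤ K ∧ ∀ x ∈ S, ‖g x‖ ≤ K := by
  obtain ⟨K, hK⟩ := hS.exists_bound_of_continuousOn hg
  exact ⟨max K 0, le_max_right _ _, fun x hx => (hK x hx).trans (le_max_left _ _)⟩

theorem linearODE_eq_zero {Q : ℝ → V →L[ℝ] V} {c d t₀ : ℝ} (hQ : ContinuousOn Q (Icc c d))
    (ht₀ : t₀ ∈ Icc c d) {f : ℝ → V}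
    (hf : ∀ t ∈ Icc c d, HasDerivWithinAt f (Q t (f t)) (Icc c d) t) (h0 : f t₀ = 0) :
    ∀ t ∈ Icc c d, f t = 0 := by
  obtain ⟨K, hK, hKb⟩ := exists_norm_le_of_continuousOn isCompact_Icc hQ
  intro t ht
  have := norm_le_of_norm_deriv_le hK le_rfl ht₀ hf
    (fun s hs => by simpa using (Q s).le_of_opNorm_le (hKb s hs) (f s)) t ht
  simpa [h0] using this

theorem linearODE_unique {Q : ℝ → V →L[ℝ] V} {c d t₀ : ℝ} (hQ : ContinuousOn Q (Icc c d))
    (ht₀ : t₀ ∈ Icc c d) {f g : ℝ → V}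
    (hf : ∀ t ∈ Icc c d, HasDerivWithinAt f (Q t (f t)) (Icc c d) t)
    (hg : ∀ t ∈ Icc c d, HasDerivWithinAt g (Q t (g t)) (Icc c d) t) (h0 : f t₀ = g t₀) :
    ∀ t ∈ Icc c d, f t = g t := by
  intro t ht
  have := linearODE_eq_zero (f := f - g) hQ ht₀
    (fun s hs => by simpa using (hf s hs).sub (hg s hs)) (by simp [h0]) t ht
  exact sub_eq_zero.1 this

/-- A linear differential equation on a compact interval has a solution with any initial value:
apply Picard-Lindelöf to the equation cut off outside the ball given by Grönwall's inequality. -/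
theorem linearODE_exists_Icc [FiniteDimensional ℝ V] {Q : ℝ → V →L[ℝ] V} {c d t₀ : ℝ}
    (hQ : ContinuousOn Q (Icc c d)) (ht₀ : t₀ ∈ Icc c d) (v : V) :
    ∃ f : ℝ → V, f t₀ = v ∧ ∀ t ∈ Icc c d, HasDerivWithinAt f (Q t (f t)) (Icc c d) t := by
  obtain ⟨K, hK, hKb⟩ := exists_norm_le_of_continuousOn isCompact_Icc hQ
  -- The Grönwall bound for a solution starting at v; the added 1 keeps R positive when v = 0.
  set R : ℝ := ‖v‖ * Real.exp (K * (d - c)) + 1 with hR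
  have hRpos : 0 < R := by positivity
  let φ : ContDiffBump (0 : V) := ⟨R, R + 1, hRpos, by linarith⟩
  have hφ : ContDiff ℝ 1 (fun x : V => φ x • x) := φ.contDiff.smul contDiff_id
  have hcs : HasCompactSupport (fun x : V => φ x • x) := φ.hasCompactSupport.smul_right
  obtain ⟨C, hC⟩ := hφ.lipschitzWith_of_hasCompactSupport hcs one_ne_zero
  obtain ⟨M, hM⟩ := hφ.continuous.bounded_above_of_compact_support hcs
  have hM0 : 0 ≤ M := (norm_nonneg _).trans (hM 0)
  have hdc : 0 ≤ d - c := sub_nonneg.2 (ht₀.1.trans ht₀.2)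
  -- The cut-off field is bounded by K M, so over the whole interval no solution leaves the ball of
  -- radius K M (d - c) about v. This makes one application of Picard-Lindelöf cover all of [c, d].
  have hPL : IsPicardLindelof (fun t x => Q t (φ x • x)) (⟨t₀, ht₀⟩ : Icc c d) v
      ⟨K * M * (d - c), by positivity⟩ 0 ⟨K * M, by positivity⟩ (⟨K, hK⟩ * C) := by
    refine ⟨fun t ht => ?_, fun x _ => ?_, fun t ht x _ => ?_, ?_⟩
    · have h1 : LipschitzWith ⟨K, hK⟩ (Q t) :=
        (Q t).lipschitz.weaken (by exact_mod_cast hKb t ht)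
      exact (h1.comp hC).lipschitzOnWith
    · exact hQ.clm_apply continuousOn_const
    · exact (Q t).le_of_opNorm_le_of_le (hKb t ht) (hM x)
    · change K * M * max (d - t₀) (t₀ - c) ≤ K * M * (d - c) - 0
      rw [sub_zero]
      exact mul_le_mul_of_nonneg_left (max_le (by linarith [ht₀.1]) (by linarith [ht₀.2]))
        (by positivity)
  obtain ⟨f, hf0, hf⟩ := hPL.exists_eq_forall_mem_Icc_hasDerivWithinAt₀
  refine ⟨f, hf0, ?_⟩
  -- Since φ ≤ 1, the cut-off equation still gives ‖f'‖ ≤ K‖f‖, so f stays where φ = 1 and solves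
  -- the original equation.
  have hbd : ∀ t ∈ Icc c d, ‖f t‖ ≤ R := by
    intro t ht
    have := norm_le_of_norm_deriv_le hK le_rfl ht₀ hf (fun s hs => by
      rw [add_zero]
      refine (Q s).le_of_opNorm_le_of_le (hKb s hs) ?_
      rw [norm_smul, Real.norm_of_nonneg φ.nonneg]
      exact mul_le_of_le_one_left (norm_nonneg _) φ.le_one) t ht
    have hf0' : f t₀ = v := hf0
    rw [hf0', zero_mul, add_zero] at this
    linarith
  intro t ht
  have h1 : φ (f t) = 1 := φ.one_of_mem_closedBall (by simpa using hbd t ht)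
  have := hf t ht
  rwa [h1, one_smul] at this

/-- Reduces global statements on an open interval to compact ones; both points lie in the interior,
so one-sided derivatives there become genuine ones. -/
theorem exists_Icc_subset_of_isOpen {J : Set ℝ} (hJ : IsOpen J) [hc : J.OrdConnected] {s t : ℝ}
    (hs : s ∈ J) (ht : t ∈ J) :
    ∃ c d, Icc c d ⊆ J ∧ s ∈ Ioo c d ∧ t ∈ Ioo c d := by
  obtain ⟨δ₁, h₁, hb₁⟩ := Metric.isOpen_iff.1 hJ (min s t)
    (by rcases min_choice s t with h | h <;> rwa [h])
  obtain ⟨δ₂, h₂, hb₂⟩ := Metric.isOpen_iff.1 hJ (max s t)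
    (by rcases max_choice s t with h | h <;> rwa [h])
  refine ⟨min s t - δ₁ / 2, max s t + δ₂ / 2, hc.out (hb₁ ?_) (hb₂ ?_), ⟨?_, ?_⟩, ⟨?_, ?_⟩⟩
  · simp only [Metric.mem_ball, Real.dist_eq]; rw [abs_lt]; constructor <;> linarith
  · simp only [Metric.mem_ball, Real.dist_eq]; rw [abs_lt]; constructor <;> linarith
  · linarith [min_le_left s t]
  · linarith [le_max_left s t]
  · linarith [min_le_right s t]
  · linarith [le_max_right s t]

/-- A linear differential equation on an open interval has a global solution with any initial
value. -/
theorem linearODE_exists [FiniteDimensional ℝ V] {Q : ℝ → V →L[ℝ] V} {J : Set ℝ}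
    (hJ : IsOpen J) [J.OrdConnected] (hQ : ContinuousOn Q J) {t₀ : ℝ} (ht₀ : t₀ ∈ J) (v : V) :
    ∃ f : ℝ → V, f t₀ = v ∧ ∀ t ∈ J, HasDerivAt f (Q t (f t)) t := by
  classical
  have hex : ∀ t : ℝ, ∃ (c d : ℝ) (f : ℝ → V), t ∈ J → Icc c d ⊆ J ∧ t₀ ∈ Ioo c d ∧ t ∈ Ioo c d ∧
      f t₀ = v ∧ ∀ s ∈ Icc c d, HasDerivWithinAt f (Q s (f s)) (Icc c d) s := by
    intro t
    by_cases ht : t ∈ J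
    · obtain ⟨c, d, hcd, h0, h1⟩ := exists_Icc_subset_of_isOpen hJ ht₀ ht
      obtain ⟨f, hf⟩ := linearODE_exists_Icc (hQ.mono hcd) (Ioo_subset_Icc_self h0) v
      exact ⟨c, d, f, fun _ => ⟨hcd, h0, h1, hf⟩⟩
    · exact ⟨0, 0, 0, fun h => absurd h ht⟩
  choose c d f hf using hex
  -- The solutions on different compact intervals agree on the overlap, which contains t₀, so the
  -- diagonal t ↦ f t t locally coincides with a single solution.
  have heq : ∀ t ∈ J, ∀ s ∈ Ioo (c t) (d t), f s s = f t s := by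
    intro t ht s hs
    obtain ⟨hsub, h0, -, hv, hd⟩ := hf t ht
    have hsJ : s ∈ J := hsub (Ioo_subset_Icc_self hs)
    obtain ⟨hsub', h0', h1', hv', hd'⟩ := hf s hsJ
    have i1 : Icc (max (c s) (c t)) (min (d s) (d t)) ⊆ Icc (c s) (d s) :=
      Icc_subset_Icc (le_max_left _ _) (min_le_left _ _)
    have i2 : Icc (max (c s) (c t)) (min (d s) (d t)) ⊆ Icc (c t) (d t) :=
      Icc_subset_Icc (le_max_right _ _) (min_le_right _ _)
    exact linearODE_unique (hQ.mono (i2.trans hsub))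
      (t₀ := t₀) ⟨max_le h0'.1.le h0.1.le, le_min h0'.2.le h0.2.le⟩
      (fun r hr => (hd' r (i1 hr)).mono i1) (fun r hr => (hd r (i2 hr)).mono i2)
      (hv'.trans hv.symm) s ⟨max_le h1'.1.le hs.1.le, le_min h1'.2.le hs.2.le⟩
  refine ⟨fun t => f t t, (hf t₀ ht₀).2.2.2.1, fun t ht => ?_⟩
  obtain ⟨hsub, h0, h1, hv, hd⟩ := hf t ht
  have h := (hd t (Ioo_subset_Icc_self h1)).hasDerivAt (Icc_mem_nhds h1.1 h1.2)
  exact h.congr_of_eventuallyEq (Filter.eventually_of_mem (Ioo_mem_nhds h1.1 h1.2) (heq t ht))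

end LinearODE

/-! ### Partial derivatives and coordinate lines. -/

section Partial

variable {F : Type*} [NormedAddCommGroup F] [NormedSpace ℝ F]

theorem hasDerivAt_pdx {f : ℝ × ℝ → F} {q : ℝ × ℝ} (hf : DifferentiableAt ℝ f q) :
    HasDerivAt (fun s => f (s, q.2)) (pdx f q) q.1 := by
  have h : HasDerivAt (fun s : ℝ => (s, q.2)) ((1, 0) : ℝ × ℝ) q.1 :=
    (hasDerivAt_id q.1).prodMk (hasDerivAt_const q.1 q.2)
  exact HasFDerivAt.comp_hasDerivAt (f := fun s : ℝ => (s, q.2)) q.1 hf.hasFDerivAt h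

theorem hasDerivAt_pdy {f : ℝ × ℝ → F} {q : ℝ × ℝ} (hf : DifferentiableAt ℝ f q) :
    HasDerivAt (fun s => f (q.1, s)) (pdy f q) q.2 := by
  have h : HasDerivAt (fun s : ℝ => (q.1, s)) ((0, 1) : ℝ × ℝ) q.2 :=
    (hasDerivAt_const q.2 q.1).prodMk (hasDerivAt_id q.2)
  exact HasFDerivAt.comp_hasDerivAt (f := fun s : ℝ => (q.1, s)) q.2 hf.hasFDerivAt h

theorem contDiffOn_pdx {f : ℝ × ℝ → F} {D : Set (ℝ × ℝ)} (hD : IsOpen D)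
    (hf : ContDiffOn ℝ ∞ f D) : ContDiffOn ℝ ∞ (pdx f) D :=
  (hf.fderiv_of_isOpen hD (by simp)).clm_apply contDiffOn_const

theorem contDiffOn_pdy {f : ℝ × ℝ → F} {D : Set (ℝ × ℝ)} (hD : IsOpen D)
    (hf : ContDiffOn ℝ ∞ f D) : ContDiffOn ℝ ∞ (pdy f) D :=
  (hf.fderiv_of_isOpen hD (by simp)).clm_apply contDiffOn_const

theorem differentiableAt_of_smooth {f : ℝ × ℝ → F} {D : Set (ℝ × ℝ)} (hD : IsOpen D)
    (hf : ContDiffOn ℝ ∞ f D) {q : ℝ × ℝ} (hq : q ∈ D) : DifferentiableAt ℝ f q :=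
  (hf.contDiffAt (hD.mem_nhds hq)).differentiableAt (by simp)

theorem fderiv_eq_pd {f : ℝ × ℝ → F} (q v : ℝ × ℝ) :
    fderiv ℝ f q v = v.1 • pdx f q + v.2 • pdy f q := by
  have : v = v.1 • ((1, 0) : ℝ × ℝ) + v.2 • ((0, 1) : ℝ × ℝ) := by ext <;> simp
  conv_lhs => rw [this, map_add, map_smul, map_smul]
  rfl

end Partial

/-! ### Linear total differential systems on a rectangle: uniqueness and the Frobenius theorem. -/

section Frobenius

variable {V : Type*} [NormedAddCommGroup V] [NormedSpace ℝ V]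

/-- A function on a rectangle whose partial derivatives depend linearly on it vanishes as soon as
it vanishes at one point. -/
theorem linearTotal_eq_zero {I J : Set ℝ} (hI : IsOpen I) [I.OrdConnected] (hJ : IsOpen J)
    [J.OrdConnected] {P Q : ℝ × ℝ → V →L[ℝ] V} (hP : ContinuousOn P (I ×ˢ J))
    (hQ : ContinuousOn Q (I ×ˢ J)) {Y : ℝ × ℝ → V} (hY : ∀ q ∈ I ×ˢ J, DifferentiableAt ℝ Y q)
    (hx : ∀ q ∈ I ×ˢ J, pdx Y q = P q (Y q)) (hy : ∀ q ∈ I ×ˢ J, pdy Y q = Q q (Y q))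
    {q₀ : ℝ × ℝ} (hq₀ : q₀ ∈ I ×ˢ J) (h0 : Y q₀ = 0) : ∀ q ∈ I ×ˢ J, Y q = 0 := by
  -- Vanishing propagates along the horizontal line through q₀, then along every vertical line that
  -- meets it.
  have step : ∀ x ∈ I, Y (x, q₀.2) = 0 := by
    intro x hxI
    obtain ⟨c, d, hcd, h1, h2⟩ := exists_Icc_subset_of_isOpen hI hq₀.1 hxI
    refine linearODE_eq_zero (Q := fun s => P (s, q₀.2)) (f := fun s => Y (s, q₀.2)) ?_
      (Ioo_subset_Icc_self h1) ?_ h0 x (Ioo_subset_Icc_self h2)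
    · exact hP.comp (by fun_prop) (fun s hs => ⟨hcd hs, hq₀.2⟩)
    · intro t ht
      have hm : (t, q₀.2) ∈ I ×ˢ J := ⟨hcd ht, hq₀.2⟩
      rw [← hx _ hm]
      exact (hasDerivAt_pdx (hY _ hm)).hasDerivWithinAt
  rintro ⟨x, y⟩ ⟨hxI, hyJ⟩
  obtain ⟨c, d, hcd, h1, h2⟩ := exists_Icc_subset_of_isOpen hJ hq₀.2 hyJ
  refine linearODE_eq_zero (Q := fun s => Q (x, s)) (f := fun s => Y (x, s)) ?_
    (Ioo_subset_Icc_self h1) ?_ (step x hxI) y (Ioo_subset_Icc_self h2)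
  · exact hQ.comp (by fun_prop) (fun s hs => ⟨hxI, hcd hs⟩)
  · intro t ht
    have hm : (x, t) ∈ I ×ˢ J := ⟨hxI, hcd ht⟩
    rw [← hy _ hm]
    exact (hasDerivAt_pdy (hY _ hm)).hasDerivWithinAt

/-- First order Taylor estimate in the first variable, uniform on a compact rectangle. -/
theorem norm_sub_sub_smul_pdx_le {W : Type*} [NormedAddCommGroup W] [NormedSpace ℝ W]
    {D : Set (ℝ × ℝ)} (hD : IsOpen D) {g : ℝ × ℝ → W} (hg : ContDiffOn ℝ ∞ g D) {S T : Set ℝ}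
    (hSc : Convex ℝ S) (hST : S ×ˢ T ⊆ D) {C : ℝ}
    (hC : ∀ q ∈ S ×ˢ T, ‖pdx (pdx g) q‖ ≤ C) {x s t : ℝ} (hx : x ∈ S) (hs : s ∈ S) (ht : t ∈ T) :
    ‖g (s, t) - g (x, t) - (s - x) • pdx g (x, t)‖ ≤ C * (s - x) ^ 2 := by
  have hlip : ∀ r ∈ S, ‖pdx g (r, t) - pdx g (x, t)‖ ≤ C * |r - x| := by
    intro r hr
    refine hSc.norm_image_sub_le_of_norm_hasDerivWithin_le (f := fun r => pdx g (r, t))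
      (fun u hu => (hasDerivAt_pdx (q := (u, t)) (differentiableAt_of_smooth hD
        (contDiffOn_pdx hD hg) (hST ⟨hu, ht⟩))).hasDerivWithinAt)
      (fun u hu => hC _ ⟨hu, ht⟩) hx hr
  have hC0 : 0 ≤ C := (norm_nonneg _).trans (hC (x, t) ⟨hx, ht⟩)
  have hseg : segment ℝ x s ⊆ S := hSc.segment_subset hx hs
  -- Mean value inequality for the remainder r ↦ g(r,t) - (r - x) g_x(x,t), whose derivative between
  -- x and s is at most C|s - x| by `hlip`.
  have := (convex_segment x s).norm_image_sub_le_of_norm_hasDerivWithin_le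
    (f := fun r => g (r, t) - (r - x) • pdx g (x, t))
    (f' := fun r => pdx g (r, t) - pdx g (x, t)) (C := C * |s - x|)
    (fun u hu => by
      have h1 := hasDerivAt_pdx (q := (u, t)) (differentiableAt_of_smooth hD hg
        (hST ⟨hseg hu, ht⟩))
      have h2 := ((hasDerivAt_id u).sub_const x).smul_const (pdx g (x, t))
      rw [one_smul] at h2
      exact (h1.sub h2).hasDerivWithinAt)
    (fun u hu => (hlip u (hseg hu)).trans (by
      refine mul_le_mul_of_nonneg_left ?_ hC0
      rw [segment_eq_uIcc] at hu
      rw [abs_sub_comm u, abs_sub_comm s]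
      have := abs_sub_left_of_mem_uIcc hu
      rwa [abs_sub_comm, abs_sub_comm x])) (left_mem_segment ℝ x s) (right_mem_segment ℝ x s)
  have e : C * |s - x| * ‖s - x‖ = C * (s - x) ^ 2 := by
    rw [Real.norm_eq_abs, mul_assoc, abs_mul_abs_self, sq]
  rw [e] at this
  simpa [sub_right_comm] using this

end Frobenius

section Frobenius

variable {V : Type*} [NormedAddCommGroup V] [NormedSpace ℝ V]

/-- Differentiability in the parameter `x` of a family of solutions of `F_y = Q F` when the initial
values satisfy `F_x = P F` and the system is flat, uniformly in `y`. -/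
theorem exists_uniform_pdx_estimate {I J : Set ℝ} (hI : IsOpen I) (hJ : IsOpen J)
    {P Q : ℝ × ℝ → V →L[ℝ] V} (hP : ContDiffOn ℝ ∞ P (I ×ˢ J))
    (hQ : ContDiffOn ℝ ∞ Q (I ×ˢ J))
    (flat : ∀ q ∈ I ×ˢ J, pdy P q + (P q).comp (Q q) = pdx Q q + (Q q).comp (P q))
    {F : ℝ × ℝ → V} {x₀ y₀ c d : ℝ} (hx₀ : x₀ ∈ I) (hcd : Icc c d ⊆ J) (hy₀ : y₀ ∈ Icc c d)
    (hFy : ∀ q ∈ I ×ˢ J, HasDerivAt (fun t => F (q.1, t)) (Q q (F q)) q.2)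
    (hFx : HasDerivAt (fun s => F (s, y₀)) (P (x₀, y₀) (F (x₀, y₀))) x₀) :
    ∃ ε : ℝ → ℝ, ε =o[𝓝 x₀] (fun s => s - x₀) ∧ ∀ᶠ s in 𝓝 x₀, ∀ t ∈ Icc c d,
      ‖F (s, t) - F (x₀, t) - (s - x₀) • P (x₀, t) (F (x₀, t))‖ ≤ ε s := by
  have hD : IsOpen (I ×ˢ J) := hI.prod hJ
  obtain ⟨r, hr, hrI⟩ := Metric.nhds_basis_closedBall.mem_iff.1 (hI.mem_nhds hx₀)
  rw [Real.closedBall_eq_Icc] at hrI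
  set S := Icc (x₀ - r) (x₀ + r) with hS
  have hx₀S : x₀ ∈ S := ⟨by linarith, by linarith⟩
  have hsub : S ×ˢ Icc c d ⊆ I ×ˢ J := prod_mono hrI hcd
  have hcomp : IsCompact (S ×ˢ Icc c d) := isCompact_Icc.prod isCompact_Icc
  have hQx := contDiffOn_pdx hD hQ
  have hQxx := contDiffOn_pdx hD hQx
  obtain ⟨K, hK, hKb⟩ := exists_norm_le_of_continuousOn hcomp (hQ.continuousOn.mono hsub)
  obtain ⟨K₁, hK₁, hKb₁⟩ := exists_norm_le_of_continuousOn hcomp (hQx.continuousOn.mono hsub)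
  obtain ⟨K₂, hK₂, hKb₂⟩ := exists_norm_le_of_continuousOn hcomp (hQxx.continuousOn.mono hsub)
  have hFc : ContinuousOn (fun t => F (x₀, t)) (Icc c d) := fun t ht =>
    (hFy (x₀, t) ⟨hx₀, hcd ht⟩).continuousAt.continuousWithinAt
  have hline : MapsTo (fun t => (x₀, t)) (Icc c d) (I ×ˢ J) := fun t ht => ⟨hx₀, hcd ht⟩
  have hHc : ContinuousOn (fun t => P (x₀, t) (F (x₀, t))) (Icc c d) :=
    (hP.continuousOn.comp (by fun_prop) hline).clm_apply hFc
  obtain ⟨M₀, hM₀, hMb₀⟩ := exists_norm_le_of_continuousOn isCompact_Icc hFc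
  obtain ⟨M₁, hM₁, hMb₁⟩ := exists_norm_le_of_continuousOn isCompact_Icc hHc
  set N := K₂ * M₀ + K₁ * M₁ with hN
  have hN0 : 0 ≤ N := by positivity
  -- The Grönwall bound for the remainder in t: its value at y₀, which is o(s - x₀) by `hFx`, plus a
  -- forcing term N (s - x₀)² accumulated over the interval.
  refine ⟨fun s => (‖F (s, y₀) - F (x₀, y₀) - (s - x₀) • P (x₀, y₀) (F (x₀, y₀))‖
    + N * (s - x₀) ^ 2 * (d - c)) * Real.exp (K * (d - c)), ?_, ?_⟩
  · have h1 := (hasDerivAt_iff_isLittleO.1 hFx).norm_left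
    have h2 : (fun s : ℝ => N * (s - x₀) ^ 2 * (d - c)) =o[𝓝 x₀] (fun s => s - x₀) := by
      have : (fun s : ℝ => (s - x₀) ^ 2) =o[𝓝 x₀] (fun s => s - x₀) := by
        have h := isLittleO_pow_sub_sub x₀ (m := 2) (by norm_num)
        simpa using h
      simpa [mul_comm, mul_left_comm, mul_assoc] using this.const_mul_left (N * (d - c))
    simpa [mul_comm] using (h1.add h2).const_mul_left (Real.exp (K * (d - c)))
  · filter_upwards [Icc_mem_nhds (show x₀ - r < x₀ by linarith) (show x₀ < x₀ + r by linarith)]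
      with s hs
    refine norm_le_of_norm_deriv_le
      (f := fun t => F (s, t) - F (x₀, t) - (s - x₀) • P (x₀, t) (F (x₀, t)))
      (f' := fun t => Q (s, t) (F (s, t)) - Q (x₀, t) (F (x₀, t)) - (s - x₀) •
        (pdx Q (x₀, t) (F (x₀, t)) + Q (x₀, t) (P (x₀, t) (F (x₀, t))))) hK
      (by positivity) hy₀ ?_ ?_
    · intro t ht
      have hm : (x₀, t) ∈ I ×ˢ J := hline ht
      have h1 := hFy (s, t) ⟨hrI hs, hcd ht⟩
      have h2 := hFy (x₀, t) hm
      have h3 := (hasDerivAt_pdy (differentiableAt_of_smooth hD hP hm)).clm_apply h2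
      -- Flatness enters here: H = P F along the line x = x₀ satisfies H_y = Q_x F + Q H, the
      -- equation obtained by formally differentiating F_y = Q F in x.
      have h4 : pdy P (x₀, t) (F (x₀, t)) + P (x₀, t) (Q (x₀, t) (F (x₀, t)))
          = pdx Q (x₀, t) (F (x₀, t)) + Q (x₀, t) (P (x₀, t) (F (x₀, t))) := by
        simpa using congrArg (fun T : V →L[ℝ] V => T (F (x₀, t))) (flat _ hm)
      have h5 : HasDerivAt (fun t => P (x₀, t) (F (x₀, t)))
          (pdx Q (x₀, t) (F (x₀, t)) + Q (x₀, t) (P (x₀, t) (F (x₀, t)))) t := by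
        rw [← h4]; exact h3
      exact ((h1.sub h2).sub (h5.const_smul (s - x₀))).hasDerivWithinAt
    · intro t ht
      have hsm : (s, t) ∈ S ×ˢ Icc c d := ⟨hs, ht⟩
      have hq2 : ‖Q (s, t) - Q (x₀, t) - (s - x₀) • pdx Q (x₀, t)‖ ≤ K₂ * (s - x₀) ^ 2 :=
        norm_sub_sub_smul_pdx_le hD hQ (convex_Icc _ _) hsub hKb₂ hx₀S hs ht
      have hq1 : ‖Q (s, t) - Q (x₀, t)‖ ≤ K₁ * |s - x₀| :=
        (convex_Icc _ _).norm_image_sub_le_of_norm_hasDerivWithin_le (f := fun r => Q (r, t))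
          (fun u hu => (hasDerivAt_pdx (q := (u, t)) (differentiableAt_of_smooth hD hQ
            (hsub ⟨hu, ht⟩))).hasDerivWithinAt) (fun u hu => hKb₁ _ ⟨hu, ht⟩) hx₀S hs
      -- The remainder thus solves w' = Q w plus two errors: the second order Taylor error of Q
      -- applied to F, and (s - x₀) times the first order error applied to P F. Both are O((s -
      -- x₀)²) uniformly in t.
      have e : Q (s, t) (F (s, t)) - Q (x₀, t) (F (x₀, t)) - (s - x₀) •
          (pdx Q (x₀, t) (F (x₀, t)) + Q (x₀, t) (P (x₀, t) (F (x₀, t))))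
          = Q (s, t) (F (s, t) - F (x₀, t) - (s - x₀) • P (x₀, t) (F (x₀, t)))
          + ((Q (s, t) - Q (x₀, t) - (s - x₀) • pdx Q (x₀, t)) (F (x₀, t))
          + (s - x₀) • (Q (s, t) - Q (x₀, t)) (P (x₀, t) (F (x₀, t)))) := by
        simp only [map_sub, map_smul, sub_apply,
          smul_apply, smul_sub, smul_add]
        abel
      rw [e]
      refine (norm_add_le _ _).trans (add_le_add ((Q (s, t)).le_of_opNorm_le (hKb _ hsm) _) ?_)
      refine (norm_add_le _ _).trans ?_
      have b1 := ContinuousLinearMap.le_of_opNorm_le_of_le _ hq2 (hMb₀ t ht)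
      have b2 := ContinuousLinearMap.le_of_opNorm_le_of_le _ hq1 (hMb₁ t ht)
      rw [norm_smul, Real.norm_eq_abs]
      have b3 := mul_le_mul_of_nonneg_left b2 (abs_nonneg (s - x₀))
      have e2 : |s - x₀| * (K₁ * |s - x₀| * M₁) = K₁ * M₁ * (s - x₀) ^ 2 := by
        rw [← sq_abs (s - x₀)]; ring
      rw [e2] at b3
      calc _ ≤ _ := add_le_add b1 b3
        _ = _ := by rw [hN]; ring

/-- A continuous solution of a total differential equation with smooth coefficients is smooth. -/
theorem contDiffOn_of_hasFDerivAt_linear {D : Set (ℝ × ℝ)} (hD : IsOpen D)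
    {P Q : ℝ × ℝ → V →L[ℝ] V} (hP : ContDiffOn ℝ ∞ P D) (hQ : ContDiffOn ℝ ∞ Q D)
    {F : ℝ × ℝ → V} (hF : ∀ q ∈ D, HasFDerivAt F
      ((ContinuousLinearMap.toSpanSingleton ℝ (P q (F q))).coprod
        (ContinuousLinearMap.toSpanSingleton ℝ (Q q (F q)))) q) : ContDiffOn ℝ ∞ F D := by
  have hdiff : DifferentiableOn ℝ F D := fun q hq =>
    (hF q hq).differentiableAt.differentiableWithinAt
  -- Bootstrap: if F is C^n, then so is its derivative, being built from P F and Q F.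
  refine contDiffOn_infty.2 fun n => ?_
  induction n with
  | zero => exact contDiffOn_zero.2 hdiff.continuousOn
  | succ n ih =>
    push_cast
    rw [contDiffOn_succ_iff_fderiv_of_isOpen hD]
    refine ⟨hdiff, by simp, ?_⟩
    have hPn : ContDiffOn ℝ n P D := hP.of_le (by exact_mod_cast le_top)
    have hQn : ContDiffOn ℝ n Q D := hQ.of_le (by exact_mod_cast le_top)
    have h1 := hPn.clm_apply ih
    have h2 := hQn.clm_apply ih
    have h3 : ContDiffOn ℝ n (fun q => (ContinuousLinearMap.fst ℝ ℝ ℝ).smulRight (P q (F q))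
        + (ContinuousLinearMap.snd ℝ ℝ ℝ).smulRight (Q q (F q))) D :=
      (contDiffOn_const.smulRight h1).add (contDiffOn_const.smulRight h2)
    refine h3.congr fun q hq => ?_
    rw [(hF q hq).fderiv]
    ext <;> simp

/-- Frobenius' theorem for linear total differential systems on a rectangle. -/
theorem linearTotal_exists [FiniteDimensional ℝ V] {I J : Set ℝ} (hI : IsOpen I) [I.OrdConnected]
    (hJ : IsOpen J) [J.OrdConnected] {P Q : ℝ × ℝ → V →L[ℝ] V} (hP : ContDiffOn ℝ ∞ P (I ×ˢ J))
    (hQ : ContDiffOn ℝ ∞ Q (I ×ˢ J))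
    (flat : ∀ q ∈ I ×ˢ J, pdy P q + (P q).comp (Q q) = pdx Q q + (Q q).comp (P q))
    {q₀ : ℝ × ℝ} (hq₀ : q₀ ∈ I ×ˢ J) (v : V) :
    ∃ F : ℝ × ℝ → V, F q₀ = v ∧ ContDiffOn ℝ ∞ F (I ×ˢ J) ∧
      ∀ q ∈ I ×ˢ J, pdx F q = P q (F q) ∧ pdy F q = Q q (F q) := by
  have hD : IsOpen (I ×ˢ J) := hI.prod hJ
  obtain ⟨x₀, y₀⟩ := q₀
  obtain ⟨hx₀, hy₀⟩ : x₀ ∈ I ∧ y₀ ∈ J := hq₀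
  -- Integrate F_x = P F along y = y₀, then F_y = Q F vertically from those values. What remains is
  -- F_x = P F off the line y = y₀, the only place where flatness is needed.
  obtain ⟨f, hf0, hf⟩ := linearODE_exists (Q := fun s => P (s, y₀)) hI
    (hP.continuousOn.comp (by fun_prop) fun s hs => ⟨hs, hy₀⟩) hx₀ v
  have hex : ∀ x : ℝ, ∃ g : ℝ → V, x ∈ I →
      g y₀ = f x ∧ ∀ t ∈ J, HasDerivAt g (Q (x, t) (g t)) t := by
    intro x
    by_cases hx : x ∈ I
    · obtain ⟨g, hg⟩ := linearODE_exists (Q := fun t => Q (x, t)) hJ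
        (hQ.continuousOn.comp (by fun_prop) fun s hs => ⟨hx, hs⟩) hy₀ (f x)
      exact ⟨g, fun _ => hg⟩
    · exact ⟨0, fun h => absurd h hx⟩
  choose g hg using hex
  let F : ℝ × ℝ → V := fun q => g q.1 q.2
  have hFy : ∀ q ∈ I ×ˢ J, HasDerivAt (fun t => F (q.1, t)) (Q q (F q)) q.2 :=
    fun q hq => (hg q.1 hq.1).2 q.2 hq.2
  have hFx₀ : ∀ x ∈ I, HasDerivAt (fun s => F (s, y₀)) (P (x, y₀) (F (x, y₀))) x := by
    intro x hx
    have h1 : F (x, y₀) = f x := (hg x hx).1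
    rw [h1]
    exact (hf x hx).congr_of_eventuallyEq
      (Filter.eventually_of_mem (hI.mem_nhds hx) fun s hs => (hg s hs).1)
  have hFx : ∀ q ∈ I ×ˢ J, HasDerivAt (fun s => F (s, q.2)) (P q (F q)) q.1 := by
    rintro ⟨x, y⟩ ⟨hx, hy⟩
    obtain ⟨c, d, hcd, h1, h2⟩ := exists_Icc_subset_of_isOpen hJ hy₀ hy
    obtain ⟨ε, hε, hb⟩ := exists_uniform_pdx_estimate hI hJ hP hQ flat hx hcd
      (Ioo_subset_Icc_self h1) hFy (hFx₀ x hx)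
    rw [hasDerivAt_iff_isLittleO]
    refine IsBigO.trans_isLittleO (IsBigO.of_bound 1 ?_) hε
    filter_upwards [hb] with s hs
    rw [one_mul]
    exact (hs y (Ioo_subset_Icc_self h2)).trans (le_abs_self _)
  -- The x-estimate is uniform in y, so separate differentiability upgrades to joint continuity.
  -- Both partial derivatives P F and Q F are then continuous, which gives total differentiability
  -- below.
  have hFc : ∀ q ∈ I ×ˢ J, ContinuousAt F q := by
    rintro ⟨x, y⟩ ⟨hx, hy⟩
    obtain ⟨c, d, hcd, h1, h2⟩ := exists_Icc_subset_of_isOpen hJ hy₀ hy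
    obtain ⟨ε, hε, hb⟩ := exists_uniform_pdx_estimate hI hJ hP hQ flat hx hcd
      (Ioo_subset_Icc_self h1) hFy (hFx₀ x hx)
    have c1 : ContinuousAt (fun t => F (x, t)) y := (hFy (x, y) ⟨hx, hy⟩).continuousAt
    have c2 : ContinuousAt (fun t => P (x, t) (F (x, t))) y := by
      have : ContinuousAt (fun t => P (x, t)) y :=
        ContinuousAt.comp (f := fun t => (x, t))
          (hP.continuousOn.continuousAt (hD.mem_nhds ⟨hx, hy⟩)) (by fun_prop)
      exact this.clm_apply c1
    have hε0 : Tendsto ε (𝓝 x) (𝓝 0) :=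
      hε.trans_tendsto (by simpa using (continuous_sub_right x).tendsto x)
    have t1 : Tendsto (fun q : ℝ × ℝ => F (q.1, q.2) - F (x, q.2)
        - (q.1 - x) • P (x, q.2) (F (x, q.2))) (𝓝 (x, y)) (𝓝 0) := by
      refine squeeze_zero_norm' (a := fun q : ℝ × ℝ => ε q.1) ?_ ?_
      · rw [nhds_prod_eq]
        filter_upwards [hb.prod_mk (Ioo_mem_nhds h2.1 h2.2)] with q hq
        exact hq.1 q.2 (Ioo_subset_Icc_self hq.2)
      · rw [nhds_prod_eq]
        exact hε0.comp tendsto_fst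
    have t2 : Tendsto (fun q : ℝ × ℝ => F (x, q.2)) (𝓝 (x, y)) (𝓝 (F (x, y))) := by
      rw [nhds_prod_eq]; exact c1.tendsto.comp tendsto_snd
    have t3 : Tendsto (fun q : ℝ × ℝ => (q.1 - x) • P (x, q.2) (F (x, q.2))) (𝓝 (x, y))
        (𝓝 ((x - x) • P (x, y) (F (x, y)))) := by
      rw [nhds_prod_eq]
      exact ((tendsto_fst (f := 𝓝 x)).sub_const x).smul (c2.tendsto.comp tendsto_snd)
    have := (t1.add t2).add t3
    simp only [sub_self, zero_smul, add_zero, zero_add] at this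
    refine this.congr fun q => ?_
    abel
  have hderiv : ∀ q ∈ I ×ˢ J, HasFDerivAt F
      ((ContinuousLinearMap.toSpanSingleton ℝ (P q (F q))).coprod
        (ContinuousLinearMap.toSpanSingleton ℝ (Q q (F q)))) q := by
    intro q hq
    have hn := hD.mem_nhds hq
    have cont : ∀ T : ℝ × ℝ → V →L[ℝ] V, ContDiffOn ℝ ∞ T (I ×ˢ J) → ContinuousAt
        (fun q : ℝ × ℝ => ContinuousLinearMap.toSpanSingleton ℝ (T q (F q))) q := by
      intro T hT
      have h1 : ContinuousAt (fun q => T q (F q)) q :=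
        (hT.continuousOn.continuousAt hn).clm_apply (hFc q hq)
      exact (ContinuousLinearMap.toSpanSingletonCLE (𝕜 := ℝ)
        (E := V)).continuous.continuousAt.comp h1
    exact (hasStrictFDerivAt_uncurry_coprod (𝕜 := ℝ) (u := q) (f := fun x y => F (x, y))
      (f₁ := fun x y => ContinuousLinearMap.toSpanSingleton ℝ (P (x, y) (F (x, y))))
      (f₂ := fun x y => ContinuousLinearMap.toSpanSingleton ℝ (Q (x, y) (F (x, y))))
      (Filter.eventually_of_mem hn fun v hv => (hFx v hv).hasFDerivAt)
      (Filter.eventually_of_mem hn fun v hv => (hFy v hv).hasFDerivAt)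
      (cont P hP) (cont Q hQ)).hasFDerivAt
  refine ⟨F, (hg x₀ hx₀).1.trans hf0, contDiffOn_of_hasFDerivAt_linear hD hP hQ hderiv,
    fun q hq => ⟨?_, ?_⟩⟩
  · rw [pdx, (hderiv q hq).fderiv]; simp
  · rw [pdy, (hderiv q hq).fderiv]; simp

end Frobenius

/-! ### Rules for `pdx` and `pdy`. -/

section Calculus

variable {F : Type*} [NormedAddCommGroup F] [NormedSpace ℝ F] {D : Set (ℝ × ℝ)} {q : ℝ × ℝ}

theorem pdx_congr {f g : ℝ × ℝ → F} (hD : IsOpen D) (h : EqOn f g D) (hq : q ∈ D) :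
    pdx f q = pdx g q := by
  rw [pdx, pdx, Filter.EventuallyEq.fderiv_eq (Filter.eventually_of_mem (hD.mem_nhds hq) h)]

theorem pdy_congr {f g : ℝ × ℝ → F} (hD : IsOpen D) (h : EqOn f g D) (hq : q ∈ D) :
    pdy f q = pdy g q := by
  rw [pdy, pdy, Filter.EventuallyEq.fderiv_eq (Filter.eventually_of_mem (hD.mem_nhds hq) h)]

theorem pdx_pdy_comm {f : ℝ × ℝ → F} (hD : IsOpen D) (hf : ContDiffOn ℝ ∞ f D) (hq : q ∈ D) :
    pdx (pdy f) q = pdy (pdx f) q := by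
  have hd : DifferentiableAt ℝ (fderiv ℝ f) q :=
    differentiableAt_of_smooth hD (hf.fderiv_of_isOpen hD (by simp)) hq
  have hs : IsSymmSndFDerivAt ℝ f q :=
    (hf.contDiffAt (hD.mem_nhds hq)).isSymmSndFDerivAt (by
      simpa using (WithTop.coe_le_coe.2 le_top : ((2 : ℕ∞) : WithTop ℕ∞) ≤ ∞))
  have h1 : pdx (pdy f) q = fderiv ℝ (fderiv ℝ f) q (1, 0) (0, 1) := by
    rw [pdx]
    change fderiv ℝ (fun q => fderiv ℝ f q (0, 1)) q (1, 0) = _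
    rw [fderiv_clm_apply hd (differentiableAt_const _)]
    simp
  have h2 : pdy (pdx f) q = fderiv ℝ (fderiv ℝ f) q (0, 1) (1, 0) := by
    rw [pdy]
    change fderiv ℝ (fun q => fderiv ℝ f q (1, 0)) q (0, 1) = _
    rw [fderiv_clm_apply hd (differentiableAt_const _)]
    simp
  rw [h1, h2]
  exact hs.eq _ _

theorem pdx_const (c : F) : pdx (fun _ => c) q = 0 := by simp [pdx]

theorem pdy_const (c : F) : pdy (fun _ => c) q = 0 := by simp [pdy]

theorem pdx_add {f g : ℝ × ℝ → F} (hf : DifferentiableAt ℝ f q) (hg : DifferentiableAt ℝ g q) :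
    pdx (fun q => f q + g q) q = pdx f q + pdx g q := by
  simp [pdx, fderiv_fun_add hf hg]

theorem pdy_add {f g : ℝ × ℝ → F} (hf : DifferentiableAt ℝ f q) (hg : DifferentiableAt ℝ g q) :
    pdy (fun q => f q + g q) q = pdy f q + pdy g q := by
  simp [pdy, fderiv_fun_add hf hg]

theorem pdx_sub {f g : ℝ × ℝ → F} (hf : DifferentiableAt ℝ f q) (hg : DifferentiableAt ℝ g q) :
    pdx (fun q => f q - g q) q = pdx f q - pdx g q := by
  simp [pdx, fderiv_fun_sub hf hg]

theorem pdy_sub {f g : ℝ × ℝ → F} (hf : DifferentiableAt ℝ f q) (hg : DifferentiableAt ℝ g q) :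
    pdy (fun q => f q - g q) q = pdy f q - pdy g q := by
  simp [pdy, fderiv_fun_sub hf hg]

theorem pdx_neg {f : ℝ × ℝ → F} : pdx (fun q => -f q) q = -pdx f q := by
  simp [pdx, fderiv_fun_neg]

theorem pdy_neg {f : ℝ × ℝ → F} : pdy (fun q => -f q) q = -pdy f q := by
  simp [pdy, fderiv_fun_neg]

theorem pdx_smul {c : ℝ × ℝ → ℝ} {f : ℝ × ℝ → F} (hc : DifferentiableAt ℝ c q)
    (hf : DifferentiableAt ℝ f q) :
    pdx (fun q => c q • f q) q = pdx c q • f q + c q • pdx f q := by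
  simp [pdx, fderiv_fun_smul hc hf, add_comm]

theorem pdy_smul {c : ℝ × ℝ → ℝ} {f : ℝ × ℝ → F} (hc : DifferentiableAt ℝ c q)
    (hf : DifferentiableAt ℝ f q) :
    pdy (fun q => c q • f q) q = pdy c q • f q + c q • pdy f q := by
  simp [pdy, fderiv_fun_smul hc hf, add_comm]

theorem pdx_mul {f g : ℝ × ℝ → ℝ} (hf : DifferentiableAt ℝ f q) (hg : DifferentiableAt ℝ g q) :
    pdx (fun q => f q * g q) q = pdx f q * g q + f q * pdx g q := by
  simpa using pdx_smul hf hg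

theorem pdy_mul {f g : ℝ × ℝ → ℝ} (hf : DifferentiableAt ℝ f q) (hg : DifferentiableAt ℝ g q) :
    pdy (fun q => f q * g q) q = pdy f q * g q + f q * pdy g q := by
  simpa using pdy_smul hf hg

theorem pdx_inv {f : ℝ × ℝ → ℝ} (hf : DifferentiableAt ℝ f q) (h0 : f q ≠ 0) :
    pdx (fun q => (f q)⁻¹) q = -pdx f q / f q ^ 2 := by
  have h : fderiv ℝ (fun q => (f q)⁻¹) q = -(f q ^ 2)⁻¹ • fderiv ℝ f q :=
    ((hasDerivAt_inv h0).comp_hasFDerivAt q hf.hasFDerivAt).fderiv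
  rw [pdx, h, pdx]
  simp [div_eq_mul_inv, mul_comm]

theorem pdy_inv {f : ℝ × ℝ → ℝ} (hf : DifferentiableAt ℝ f q) (h0 : f q ≠ 0) :
    pdy (fun q => (f q)⁻¹) q = -pdy f q / f q ^ 2 := by
  have h : fderiv ℝ (fun q => (f q)⁻¹) q = -(f q ^ 2)⁻¹ • fderiv ℝ f q :=
    ((hasDerivAt_inv h0).comp_hasFDerivAt q hf.hasFDerivAt).fderiv
  rw [pdy, h, pdy]
  simp [div_eq_mul_inv, mul_comm]

theorem pdx_inner {f g : ℝ × ℝ → E3} (hf : DifferentiableAt ℝ f q) (hg : DifferentiableAt ℝ g q) :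
    pdx (fun q => inner ℝ (f q) (g q)) q = inner ℝ (f q) (pdx g q) + inner ℝ (pdx f q) (g q) := by
  rw [pdx, fderiv_inner_apply ℝ hf hg]; rfl

theorem pdy_inner {f g : ℝ × ℝ → E3} (hf : DifferentiableAt ℝ f q) (hg : DifferentiableAt ℝ g q) :
    pdy (fun q => inner ℝ (f q) (g q)) q = inner ℝ (f q) (pdy g q) + inner ℝ (pdy f q) (g q) := by
  rw [pdy, fderiv_inner_apply ℝ hf hg]; rfl

theorem pdx_clm {G : Type*} [NormedAddCommGroup G] [NormedSpace ℝ G] (T : F →L[ℝ] G)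
    {f : ℝ × ℝ → F} (hf : DifferentiableAt ℝ f q) : pdx (fun q => T (f q)) q = T (pdx f q) := by
  have := (T.hasFDerivAt.comp q hf.hasFDerivAt).fderiv
  rw [pdx]
  exact congrArg (fun L : ℝ × ℝ →L[ℝ] G => L (1, 0)) this

theorem pdy_clm {G : Type*} [NormedAddCommGroup G] [NormedSpace ℝ G] (T : F →L[ℝ] G)
    {f : ℝ × ℝ → F} (hf : DifferentiableAt ℝ f q) : pdy (fun q => T (f q)) q = T (pdy f q) := by
  have := (T.hasFDerivAt.comp q hf.hasFDerivAt).fderiv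
  rw [pdy]
  exact congrArg (fun L : ℝ × ℝ →L[ℝ] G => L (0, 1)) this

theorem pdx_pi {ι : Type*} [Fintype ι] {f : ℝ × ℝ → ι → F} (hf : DifferentiableAt ℝ f q) :
    pdx f q = fun i => pdx (fun q => f q i) q := by
  ext i
  exact (pdx_clm (ContinuousLinearMap.proj (R := ℝ) (φ := fun _ : ι => F) i) hf).symm

theorem pdy_pi {ι : Type*} [Fintype ι] {f : ℝ × ℝ → ι → F} (hf : DifferentiableAt ℝ f q) :
    pdy f q = fun i => pdy (fun q => f q i) q := by
  ext i
  exact (pdy_clm (ContinuousLinearMap.proj (R := ℝ) (φ := fun _ : ι => F) i) hf).symm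

end Calculus

/-! ### Total systems given by matrices of functions acting on tuples of vectors. -/

section MatrixSystem

variable {n : ℕ} {E : Type*} [NormedAddCommGroup E] [NormedSpace ℝ E]

variable (E) in
/-- A square real matrix acting on tuples of vectors. -/
noncomputable def tupleAction (n : ℕ) :
    (Fin n → Fin n → ℝ) →L[ℝ] ((Fin n → E) →L[ℝ] (Fin n → E)) :=
  ∑ i, ∑ j, ((ContinuousLinearMap.proj (R := ℝ) (φ := fun _ : Fin n => ℝ) j).comp
    (ContinuousLinearMap.proj (R := ℝ) (φ := fun _ : Fin n => Fin n → ℝ) i)).smulRight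
      ((ContinuousLinearMap.single ℝ (fun _ : Fin n => E) i).comp
        (ContinuousLinearMap.proj (R := ℝ) (φ := fun _ : Fin n => E) j))

theorem tupleAction_apply (M : Fin n → Fin n → ℝ) (v : Fin n → E) (i : Fin n) :
    tupleAction E n M v i = ∑ j, M i j • v j := by
  simp [tupleAction, Finset.sum_apply, Pi.single_apply]

/-- Turns the operator form of flatness into an identity between matrix entries. -/
theorem tupleAction_comp (M N : Fin n → Fin n → ℝ) :
    (tupleAction E n M).comp (tupleAction E n N)
      = tupleAction E n (fun i j => ∑ k, M i k * N k j) := by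
  ext v i
  simp only [ContinuousLinearMap.comp_apply, tupleAction_apply, Finset.smul_sum, Finset.sum_smul,
    smul_smul]
  exact Finset.sum_comm

variable {I J : Set ℝ} {P Q : Fin n → Fin n → ℝ × ℝ → ℝ}

theorem contDiffOn_tupleAction {D : Set (ℝ × ℝ)} (hP : ∀ i j, ContDiffOn ℝ ∞ (P i j) D) :
    ContDiffOn ℝ ∞ (fun q => tupleAction E n (fun i j => P i j q)) D :=
  (tupleAction E n).contDiff.comp_contDiffOn
    (contDiffOn_pi.2 fun i => contDiffOn_pi.2 fun j => hP i j)

/-- A tuple solving a homogeneous linear total differential system and vanishing at one point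
vanishes identically. -/
theorem tuple_eq_zero (hI : IsOpen I) [I.OrdConnected] (hJ : IsOpen J) [J.OrdConnected]
    (hP : ∀ i j, ContDiffOn ℝ ∞ (P i j) (I ×ˢ J)) (hQ : ∀ i j, ContDiffOn ℝ ∞ (Q i j) (I ×ˢ J))
    {Y : Fin n → ℝ × ℝ → E} (hY : ∀ i, ∀ q ∈ I ×ˢ J, DifferentiableAt ℝ (Y i) q)
    (hx : ∀ i, ∀ q ∈ I ×ˢ J, pdx (Y i) q = ∑ j, P i j q • Y j q)
    (hy : ∀ i, ∀ q ∈ I ×ˢ J, pdy (Y i) q = ∑ j, Q i j q • Y j q)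
    {q₀ : ℝ × ℝ} (hq₀ : q₀ ∈ I ×ˢ J) (h0 : ∀ i, Y i q₀ = 0) :
    ∀ q ∈ I ×ˢ J, ∀ i, Y i q = 0 := by
  have hd : ∀ q ∈ I ×ˢ J, DifferentiableAt ℝ (fun q i => Y i q) q :=
    fun q hq => differentiableAt_pi.2 fun i => hY i q hq
  have := linearTotal_eq_zero (V := Fin n → E) (Y := fun q i => Y i q) hI hJ
    (contDiffOn_tupleAction hP).continuousOn (contDiffOn_tupleAction hQ).continuousOn hd
    (fun q hq => by
      ext i
      rw [pdx_pi (hd q hq), tupleAction_apply]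
      exact hx i q hq)
    (fun q hq => by
      ext i
      rw [pdy_pi (hd q hq), tupleAction_apply]
      exact hy i q hq) hq₀ (funext h0)
  exact fun q hq i => congrFun (this q hq) i

/-- Frobenius' theorem for a flat homogeneous linear total differential system on a rectangle. -/
theorem exists_tuple [FiniteDimensional ℝ E] (hI : IsOpen I) [I.OrdConnected] (hJ : IsOpen J)
    [J.OrdConnected] (hP : ∀ i j, ContDiffOn ℝ ∞ (P i j) (I ×ˢ J))
    (hQ : ∀ i j, ContDiffOn ℝ ∞ (Q i j) (I ×ˢ J))
    (flat : ∀ q ∈ I ×ˢ J, ∀ i j, pdy (P i j) q + ∑ k, P i k q * Q k j q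
      = pdx (Q i j) q + ∑ k, Q i k q * P k j q)
    {q₀ : ℝ × ℝ} (hq₀ : q₀ ∈ I ×ˢ J) (v : Fin n → E) :
    ∃ Y : Fin n → ℝ × ℝ → E, (∀ i, Y i q₀ = v i) ∧ (∀ i, ContDiffOn ℝ ∞ (Y i) (I ×ˢ J)) ∧
      (∀ i, ∀ q ∈ I ×ˢ J, pdx (Y i) q = ∑ j, P i j q • Y j q) ∧
      (∀ i, ∀ q ∈ I ×ˢ J, pdy (Y i) q = ∑ j, Q i j q • Y j q) := by
  have hD : IsOpen (I ×ˢ J) := hI.prod hJ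
  have hM : ∀ {M : Fin n → Fin n → ℝ × ℝ → ℝ}, (∀ i j, ContDiffOn ℝ ∞ (M i j) (I ×ˢ J)) →
      ∀ q ∈ I ×ˢ J, DifferentiableAt ℝ (fun q i j => M i j q) q := fun hM q hq =>
    differentiableAt_pi.2 fun i => differentiableAt_pi.2 fun j =>
      differentiableAt_of_smooth hD (hM i j) hq
  obtain ⟨F, hF0, hF, hF'⟩ := linearTotal_exists (V := Fin n → E) hI hJ
    (contDiffOn_tupleAction hP) (contDiffOn_tupleAction hQ) (fun q hq => by
      rw [pdx_clm _ (hM hQ q hq), pdy_clm _ (hM hP q hq), tupleAction_comp, tupleAction_comp,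
        ← map_add, ← map_add]
      congr 1
      rw [pdx_pi (hM hQ q hq), pdy_pi (hM hP q hq)]
      ext i j
      simp only [Pi.add_apply]
      rw [pdx_pi (f := fun q j => Q i j q) (differentiableAt_pi.1 (hM hQ q hq) i),
        pdy_pi (f := fun q j => P i j q) (differentiableAt_pi.1 (hM hP q hq) i)]
      exact flat q hq i j) hq₀ v
  have hd : ∀ q ∈ I ×ˢ J, DifferentiableAt ℝ F q :=
    fun q hq => differentiableAt_of_smooth hD hF hq
  refine ⟨fun i q => F q i, fun i => congrFun hF0 i, contDiffOn_pi.1 hF, fun i q hq => ?_,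
    fun i q hq => ?_⟩
  · rw [← tupleAction_apply (fun i j => P i j q), ← (hF' q hq).1, pdx_pi (hd q hq)]
  · rw [← tupleAction_apply (fun i j => Q i j q), ← (hF' q hq).2, pdy_pi (hd q hq)]

end MatrixSystem

section Lines

variable {F : Type*} [NormedAddCommGroup F] [NormedSpace ℝ F] {D : Set (ℝ × ℝ)} {f : ℝ × ℝ → F}

theorem hasDerivAt_line_x (hD : IsOpen D) (hf : ContDiffOn ℝ ∞ f D) {x y : ℝ} (hq : (x, y) ∈ D) :
    HasDerivAt (fun s => f (s, y)) (pdx f (x, y)) x :=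
  hasDerivAt_pdx (differentiableAt_of_smooth hD hf hq)

theorem hasDerivAt_line_y (hD : IsOpen D) (hf : ContDiffOn ℝ ∞ f D) {x y : ℝ} (hq : (x, y) ∈ D) :
    HasDerivAt (fun s => f (x, s)) (pdy f (x, y)) y :=
  hasDerivAt_pdy (differentiableAt_of_smooth hD hf hq)

end Lines

/-! ### Orthogonal frames in Euclidean 3-space. -/

section OrthogonalFrame

theorem inner_eq_sum (x y : E3) : inner ℝ x y = ∑ k, x k * y k := by
  simp [PiLp.inner_apply, mul_comm]

/-- Three vectors of `E3` are orthogonal with squared norms `1 / c i` if and only if the quadratic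
form `∑ c i ⟪f i, ·⟫²` is the Euclidean one. -/
theorem gram_eq_iff (f : Fin 3 → E3) (c : Fin 3 → ℝ) (hc : ∀ i, c i ≠ 0) :
    (∀ i j, inner ℝ (f i) (f j) = if i = j then (c i)⁻¹ else 0) ↔
      ∀ k l, ∑ i, c i * (f i k * f i l) = if k = l then 1 else 0 := by
  -- With the f i as rows of O, the two conditions read (diag c) O Oᵀ = 1 and Oᵀ (diag c) O = 1; a
  -- one-sided inverse of a square matrix is two-sided.
  let O : Matrix (Fin 3) (Fin 3) ℝ := Matrix.of fun i k => f i k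
  have h1 : (∀ i j, inner ℝ (f i) (f j) = if i = j then (c i)⁻¹ else 0) ↔
      Matrix.diagonal c * O * O.transpose = 1 := by
    rw [← Matrix.ext_iff]
    refine forall_congr' fun i => forall_congr' fun j => ?_
    rw [Matrix.mul_apply, inner_eq_sum, Matrix.one_apply]
    have : ∑ k, (Matrix.diagonal c * O) i k * O.transpose k j = c i * ∑ k, f i k * f j k := by
      rw [Finset.mul_sum]
      refine Finset.sum_congr rfl fun k _ => ?_
      rw [Matrix.diagonal_mul, mul_assoc]
      rfl
    rw [this]
    split_ifs
    · rw [mul_comm, mul_eq_one_iff_eq_inv₀ (hc i)]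
    · simp [hc i]
  have h2 : (∀ k l, ∑ i, c i * (f i k * f i l) = if k = l then 1 else 0) ↔
      O.transpose * (Matrix.diagonal c * O) = 1 := by
    rw [← Matrix.ext_iff]
    refine forall_congr' fun k => forall_congr' fun l => ?_
    rw [Matrix.mul_apply, Matrix.one_apply]
    have : ∑ i, O.transpose k i * (Matrix.diagonal c * O) i l = ∑ i, c i * (f i k * f i l) := by
      refine Finset.sum_congr rfl fun i _ => ?_
      rw [Matrix.diagonal_mul, mul_left_comm]
      rfl
    rw [this]
  rw [h1, h2, mul_eq_one_comm]

/-- The dual form of the Gram condition is a resolution of the identity; apply it to z. -/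
theorem frame_expansion {f : Fin 3 → E3} {c : Fin 3 → ℝ} (hc : ∀ i, c i ≠ 0)
    (h : ∀ i j, inner ℝ (f i) (f j) = if i = j then (c i)⁻¹ else 0) (z : E3) :
    z = ∑ i, (c i * inner ℝ (f i) z) • f i := by
  have hk := (gram_eq_iff f c hc).1 h
  ext k
  have h1 : z k = ∑ l, (∑ i, c i * (f i k * f i l)) * z l := by
    simp [hk]
  rw [h1]
  simp only [WithLp.ofLp_sum, WithLp.ofLp_smul, Finset.sum_apply, Pi.smul_apply, smul_eq_mul,
    inner_eq_sum, Finset.sum_mul, Finset.mul_sum]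
  rw [Finset.sum_comm]
  exact Finset.sum_congr rfl fun i _ => Finset.sum_congr rfl fun l _ => by ring

/-- Pairwise inner products of an orthogonal frame in matrix form. -/
theorem gram_of_orthogonal {u v N : E3} {a b : ℝ}
    (huu : inner ℝ u u = a⁻¹) (hvv : inner ℝ v v = b⁻¹) (hNN : inner ℝ N N = (1 : ℝ))
    (huv : inner ℝ u v = (0 : ℝ)) (hNu : inner ℝ N u = (0 : ℝ)) (hNv : inner ℝ N v = (0 : ℝ))
    (i j : Fin 3) :
    inner ℝ (![u, v, N] i) (![u, v, N] j) = if i = j then (![a, b, 1] i)⁻¹ else 0 := by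
  have hvu : inner ℝ v u = (0 : ℝ) := by rw [real_inner_comm, huv]
  have huN : inner ℝ u N = (0 : ℝ) := by rw [real_inner_comm, hNu]
  have hvN : inner ℝ v N = (0 : ℝ) := by rw [real_inner_comm, hNv]
  fin_cases i <;> fin_cases j <;>
    simp [huu, hvv, hNN, huv, hNu, hNv, hvu, huN, hvN, -inner_self_eq_norm_sq_to_K]

/-- Expansion of a vector in an orthogonal frame `u, v, N` with `|u|² = 1/a`, `|v|² = 1/b`,
`|N| = 1`. -/
theorem eq_frame_combination {u v N : E3} {a b : ℝ} (ha : a ≠ 0) (hb : b ≠ 0)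
    (huu : inner ℝ u u = a⁻¹) (hvv : inner ℝ v v = b⁻¹) (hNN : inner ℝ N N = (1 : ℝ))
    (huv : inner ℝ u v = (0 : ℝ)) (hNu : inner ℝ N u = (0 : ℝ)) (hNv : inner ℝ N v = (0 : ℝ))
    (z : E3) : z = (a * inner ℝ u z) • u + (b * inner ℝ v z) • v + inner ℝ N z • N := by
  have hc : ∀ i, ![a, b, 1] i ≠ 0 := by intro i; fin_cases i <;> simp [ha, hb]
  have := frame_expansion (f := ![u, v, N]) hc
    (gram_of_orthogonal huu hvv hNN huv hNu hNv) z
  simpa [Fin.sum_univ_three] using this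

theorem inner_eq_frame_sum {u v N : E3} {a b : ℝ} (ha : a ≠ 0) (hb : b ≠ 0)
    (huu : inner ℝ u u = a⁻¹) (hvv : inner ℝ v v = b⁻¹) (hNN : inner ℝ N N = (1 : ℝ))
    (huv : inner ℝ u v = (0 : ℝ)) (hNu : inner ℝ N u = (0 : ℝ)) (hNv : inner ℝ N v = (0 : ℝ))
    (y z : E3) : inner ℝ y z = a * inner ℝ u y * inner ℝ u z + b * inner ℝ v y * inner ℝ v z
      + inner ℝ N y * inner ℝ N z := by
  conv_lhs => rw [eq_frame_combination ha hb huu hvv hNN huv hNu hNv y]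
  simp only [inner_add_left, real_inner_smul_left]

end OrthogonalFrame

/-! ### Moving frame of a realization: Weingarten's and Codazzi's equations. -/

namespace Realization

variable {D : Set (ℝ × ℝ)} {A B : ℝ × ℝ → ℝ} (r : Realization D A B) {q : ℝ × ℝ}

theorem inner_N_pdx (hq : q ∈ D) : inner ℝ (r.N q) (pdx r.X q) = (0 : ℝ) := r.orthogonal q hq _

theorem inner_N_pdy (hq : q ∈ D) : inner ℝ (r.N q) (pdy r.X q) = (0 : ℝ) := r.orthogonal q hq _

theorem inner_N_N (hq : q ∈ D) : inner ℝ (r.N q) (r.N q) = (1 : ℝ) := by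
  rw [real_inner_self_eq_norm_sq, r.unit_normal q hq, one_pow]

/-- Eigenvectors of a self-adjoint operator for distinct eigenvalues are orthogonal. -/
theorem inner_pdx_pdy (hne : A q ≠ B q) (hq : q ∈ D) :
    inner ℝ (pdx r.X q) (pdy r.X q) = (0 : ℝ) := by
  have h1 := r.shape_right q hq (1, 0) (0, 1)
  have h2 := r.shape_left q hq (1, 0) (0, 1)
  rw [h1] at h2
  simp only [firstForm, diagOp, fderiv_eq_pd, mul_zero, mul_one, zero_smul, one_smul, zero_add,
    add_zero, real_inner_smul_left, real_inner_smul_right] at h2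
  have : (A q - B q) * inner ℝ (pdx r.X q) (pdy r.X q) = 0 := by linarith
  exact (mul_eq_zero.1 this).resolve_left (sub_ne_zero.2 hne)

theorem a_eq (q : ℝ × ℝ) : r.a q = (inner ℝ (pdx r.X q) (pdx r.X q))⁻¹ := rfl

theorem b_eq (q : ℝ × ℝ) : r.b q = (inner ℝ (pdy r.X q) (pdy r.X q))⁻¹ := rfl

theorem inner_pdx_pdx (q : ℝ × ℝ) : inner ℝ (pdx r.X q) (pdx r.X q) = (r.a q)⁻¹ := by
  rw [a_eq, inv_inv]

theorem inner_pdy_pdy (q : ℝ × ℝ) : inner ℝ (pdy r.X q) (pdy r.X q) = (r.b q)⁻¹ := by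
  rw [b_eq, inv_inv]

theorem a_pos (hq : q ∈ D) : 0 < r.a q := by
  rw [a_eq, inv_pos, real_inner_self_pos]
  intro h
  have := r.immersion q hq (a₁ := (1, 0)) (a₂ := 0) (by rw [map_zero]; exact h)
  simp at this

theorem b_pos (hq : q ∈ D) : 0 < r.b q := by
  rw [b_eq, inv_pos, real_inner_self_pos]
  intro h
  have := r.immersion q hq (a₁ := (0, 1)) (a₂ := 0) (by rw [map_zero]; exact h)
  simp at this

theorem frame_combination (hne : A q ≠ B q) (hq : q ∈ D) (z : E3) :
    z = (r.a q * inner ℝ (pdx r.X q) z) • pdx r.X q + (r.b q * inner ℝ (pdy r.X q) z) • pdy r.X q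
      + inner ℝ (r.N q) z • r.N q :=
  eq_frame_combination (r.a_pos hq).ne' (r.b_pos hq).ne' (r.inner_pdx_pdx q) (r.inner_pdy_pdy q)
    (r.inner_N_N hq) (r.inner_pdx_pdy hne hq) (r.inner_N_pdx hq) (r.inner_N_pdy hq) z

theorem inner_eq_sum_frame (hne : A q ≠ B q) (hq : q ∈ D) (y z : E3) :
    inner ℝ y z = r.a q * inner ℝ (pdx r.X q) y * inner ℝ (pdx r.X q) z
      + r.b q * inner ℝ (pdy r.X q) y * inner ℝ (pdy r.X q) z
      + inner ℝ (r.N q) y * inner ℝ (r.N q) z :=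
  inner_eq_frame_sum (r.a_pos hq).ne' (r.b_pos hq).ne' (r.inner_pdx_pdx q) (r.inner_pdy_pdy q)
    (r.inner_N_N hq) (r.inner_pdx_pdy hne hq) (r.inner_N_pdx hq) (r.inner_N_pdy hq) y z

theorem smooth_pdx_X (hD : IsOpen D) : ContDiffOn ℝ ∞ (pdx r.X) D := contDiffOn_pdx hD r.smooth_X

theorem smooth_pdy_X (hD : IsOpen D) : ContDiffOn ℝ ∞ (pdy r.X) D := contDiffOn_pdy hD r.smooth_X

theorem smooth_a (hD : IsOpen D) : ContDiffOn ℝ ∞ r.a D :=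
  ((r.smooth_pdx_X hD).inner ℝ (r.smooth_pdx_X hD)).inv fun q hq => by
    rw [r.inner_pdx_pdx]; exact inv_ne_zero (r.a_pos hq).ne'

theorem smooth_b (hD : IsOpen D) : ContDiffOn ℝ ∞ r.b D :=
  ((r.smooth_pdy_X hD).inner ℝ (r.smooth_pdy_X hD)).inv fun q hq => by
    rw [r.inner_pdy_pdy]; exact inv_ne_zero (r.b_pos hq).ne'

theorem inner_N_pdx_N (hD : IsOpen D) (hq : q ∈ D) : inner ℝ (r.N q) (pdx r.N q) = (0 : ℝ) := by
  have hd := differentiableAt_of_smooth hD r.smooth_N hq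
  have h1 := pdx_inner hd hd
  rw [pdx_congr hD (g := fun _ => (1 : ℝ)) (fun p hp => r.inner_N_N hp) hq, pdx_const,
    real_inner_comm (r.N q)] at h1
  linarith

theorem inner_N_pdy_N (hD : IsOpen D) (hq : q ∈ D) : inner ℝ (r.N q) (pdy r.N q) = (0 : ℝ) := by
  have hd := differentiableAt_of_smooth hD r.smooth_N hq
  have h1 := pdy_inner hd hd
  rw [pdy_congr hD (g := fun _ => (1 : ℝ)) (fun p hp => r.inner_N_N hp) hq, pdy_const,
    real_inner_comm (r.N q)] at h1
  linarith

/-- Weingarten's equation in the first principal direction. -/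
theorem pdx_N (hD : IsOpen D) (hne : A q ≠ B q) (hq : q ∈ D) :
    pdx r.N q = -(A q • pdx r.X q) := by
  have h1 := r.shape_right q hq (1, 0) (1, 0)
  have h2 := r.shape_right q hq (1, 0) (0, 1)
  simp only [firstForm, secondForm, diagOp, fderiv_eq_pd, mul_zero, mul_one, zero_smul, one_smul,
    zero_add, add_zero, real_inner_smul_right, r.inner_pdx_pdy hne hq] at h1 h2
  rw [r.frame_combination hne hq (pdx r.N q), r.inner_N_pdx_N hD hq, real_inner_comm _ (pdx r.X q),
    real_inner_comm _ (pdy r.X q), neg_eq_zero.1 h2, neg_eq_iff_eq_neg.1 h1, r.inner_pdx_pdx]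
  have := (r.a_pos hq).ne'
  rw [show r.a q * -(A q * (r.a q)⁻¹) = -A q by field_simp]
  simp

/-- Weingarten's equation in the second principal direction. -/
theorem pdy_N (hD : IsOpen D) (hne : A q ≠ B q) (hq : q ∈ D) :
    pdy r.N q = -(B q • pdy r.X q) := by
  have h1 := r.shape_right q hq (0, 1) (0, 1)
  have h2 := r.shape_right q hq (0, 1) (1, 0)
  have h3 := r.inner_pdx_pdy hne hq
  rw [real_inner_comm] at h3
  simp only [firstForm, secondForm, diagOp, fderiv_eq_pd, mul_zero, mul_one, zero_smul, one_smul,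
    zero_add, add_zero, real_inner_smul_right, h3] at h1 h2
  rw [r.frame_combination hne hq (pdy r.N q), r.inner_N_pdy_N hD hq, real_inner_comm _ (pdx r.X q),
    real_inner_comm _ (pdy r.X q), neg_eq_zero.1 h2, neg_eq_iff_eq_neg.1 h1, r.inner_pdy_pdy]
  have := (r.b_pos hq).ne'
  rw [show r.b q * -(B q * (r.b q)⁻¹) = -B q by field_simp]
  simp

variable (hD : IsOpen D) (hA : ContDiffOn ℝ ∞ A D) (hB : ContDiffOn ℝ ∞ B D)
  (hne : ∀ q ∈ D, A q ≠ B q)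
include hD hA hB hne

/-- The mixed second derivative of the immersion (Codazzi's equations). -/
theorem pdy_pdx_X (hq : q ∈ D) : pdy (pdx r.X) q =
    (pdx B q / (A q - B q)) • pdy r.X q - (pdy A q / (A q - B q)) • pdx r.X q := by
  -- Differentiate N_x = -A X_x and N_y = -B X_y crosswise; equality of the mixed derivatives of N
  -- and of X leaves (A - B) X_xy = B_x X_y - A_y X_x.
  have h1 : pdy (pdx r.N) q = -(pdy A q • pdx r.X q + A q • pdy (pdx r.X) q) := by
    rw [pdy_congr hD (fun p hp => r.pdx_N hD (hne p hp) hp) hq, pdy_neg,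
      pdy_smul (differentiableAt_of_smooth hD hA hq)
        (differentiableAt_of_smooth hD (r.smooth_pdx_X hD) hq)]
  have h2 : pdx (pdy r.N) q = -(pdx B q • pdy r.X q + B q • pdx (pdy r.X) q) := by
    rw [pdx_congr hD (fun p hp => r.pdy_N hD (hne p hp) hp) hq, pdx_neg,
      pdx_smul (differentiableAt_of_smooth hD hB hq)
        (differentiableAt_of_smooth hD (r.smooth_pdy_X hD) hq)]
  rw [pdx_pdy_comm hD r.smooth_N hq, h1, pdx_pdy_comm hD r.smooth_X hq, neg_inj] at h2
  have h0 := sub_ne_zero.2 (hne q hq)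
  have h3 : (A q - B q) • pdy (pdx r.X) q = pdx B q • pdy r.X q - pdy A q • pdx r.X q := by
    rw [sub_smul, sub_eq_sub_iff_add_eq_add, add_comm, h2, add_comm]
  rw [div_eq_inv_mul, div_eq_inv_mul, mul_smul, mul_smul, ← smul_sub, ← h3, smul_smul,
    inv_mul_cancel₀ h0, one_smul]

theorem inner_pdx_mixed (hq : q ∈ D) : inner ℝ (pdx r.X q) (pdy (pdx r.X) q) =
    -(pdy A q / (A q - B q) / r.a q) := by
  rw [r.pdy_pdx_X hD hA hB hne hq, inner_sub_right, real_inner_smul_right, real_inner_smul_right,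
    r.inner_pdx_pdy (hne q hq) hq, r.inner_pdx_pdx]
  ring

theorem inner_pdy_mixed (hq : q ∈ D) : inner ℝ (pdy r.X q) (pdy (pdx r.X) q) =
    pdx B q / (A q - B q) / r.b q := by
  rw [r.pdy_pdx_X hD hA hB hne hq, inner_sub_right, real_inner_smul_right, real_inner_smul_right,
    real_inner_comm (pdx r.X q) (pdy r.X q), r.inner_pdx_pdy (hne q hq) hq, r.inner_pdy_pdy]
  ring

/-- Differentiating |X_x|² = 1/a in y only involves the X_x-component of X_xy, which Codazzi
provides. -/
theorem pdy_a (hq : q ∈ D) : pdy r.a q = 2 * pdy A q / (A q - B q) * r.a q := by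
  have hd := differentiableAt_of_smooth hD (r.smooth_pdx_X hD) hq
  have h0 := (r.a_pos hq).ne'
  have h1 := pdy_inv (hd.inner ℝ hd) (by rw [r.inner_pdx_pdx]; exact inv_ne_zero h0)
  have h2 : pdy r.a q = _ := h1
  rw [h2, pdy_inner hd hd, real_inner_comm (pdx r.X q), r.inner_pdx_mixed hD hA hB hne hq,
    r.inner_pdx_pdx]
  field_simp
  ring

theorem pdx_b (hq : q ∈ D) : pdx r.b q = 2 * pdx B q / (B q - A q) * r.b q := by
  have hd := differentiableAt_of_smooth hD (r.smooth_pdy_X hD) hq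
  have h0 := (r.b_pos hq).ne'
  have h1 := pdx_inv (hd.inner ℝ hd) (by rw [r.inner_pdy_pdy]; exact inv_ne_zero h0)
  have h2 : pdx r.b q = _ := h1
  rw [h2, pdx_inner hd hd, real_inner_comm (pdy r.X q), pdx_pdy_comm hD r.smooth_X hq,
    r.inner_pdy_mixed hD hA hB hne hq, r.inner_pdy_pdy, ← neg_sub (A q)]
  field_simp
  ring

end Realization

/-! ### Prolongation: the derivatives of p forced by the equations for a and b. -/

section Derivation

variable {D : Set (ℝ × ℝ)} {A B a b p : ℝ × ℝ → ℝ}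

/-- Since a_xy = a_yx, differentiating the equation for a_y in x eliminates the mixed second
derivative of a. -/
theorem pdy_pdx_of_pdy_eq (hD : IsOpen D) (hA : ContDiffOn ℝ ∞ A D) (hB : ContDiffOn ℝ ∞ B D)
    (hne : ∀ q ∈ D, A q ≠ B q) (ha : ContDiffOn ℝ ∞ a D)
    (hay : ∀ q ∈ D, pdy a q = 2 * pdy A q / (A q - B q) * a q) {x y : ℝ} (hq : (x, y) ∈ D) :
    pdy (pdx a) (x, y) = (2 * pdx (pdy A) (x, y) * (A (x, y) - B (x, y))
      - 2 * pdy A (x, y) * (pdx A (x, y) - pdx B (x, y))) / (A (x, y) - B (x, y)) ^ 2 * a (x, y)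
      + 2 * pdy A (x, y) / (A (x, y) - B (x, y)) * pdx a (x, y) := by
  have h0 := sub_ne_zero.2 (hne _ hq)
  rw [← pdx_pdy_comm hD ha hq, pdx_congr hD hay hq]
  have h1 := (((hasDerivAt_line_x hD (contDiffOn_pdy hD hA) hq).const_mul 2).div
    ((hasDerivAt_line_x hD hA hq).sub (hasDerivAt_line_x hD hB hq)) h0).mul
    (hasDerivAt_line_x hD ha hq)
  refine (hasDerivAt_line_x hD ?_ hq).unique h1
  exact ((contDiffOn_const.mul (contDiffOn_pdy hD hA)).div (hA.sub hB)
    fun q hq => sub_ne_zero.2 (hne q hq)).mul ha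

theorem pdx_pdy_of_pdx_eq (hD : IsOpen D) (hA : ContDiffOn ℝ ∞ A D) (hB : ContDiffOn ℝ ∞ B D)
    (hne : ∀ q ∈ D, A q ≠ B q) (hb : ContDiffOn ℝ ∞ b D)
    (hbx : ∀ q ∈ D, pdx b q = 2 * pdx B q / (B q - A q) * b q) {x y : ℝ} (hq : (x, y) ∈ D) :
    pdx (pdy b) (x, y) = (2 * pdy (pdx B) (x, y) * (B (x, y) - A (x, y))
      - 2 * pdx B (x, y) * (pdy B (x, y) - pdy A (x, y))) / (B (x, y) - A (x, y)) ^ 2 * b (x, y)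
      + 2 * pdx B (x, y) / (B (x, y) - A (x, y)) * pdy b (x, y) := by
  have h0 := sub_ne_zero.2 (hne _ hq).symm
  rw [pdx_pdy_comm hD hb hq, pdy_congr hD hbx hq]
  have h1 := (((hasDerivAt_line_y hD (contDiffOn_pdx hD hB) hq).const_mul 2).div
    ((hasDerivAt_line_y hD hB hq).sub (hasDerivAt_line_y hD hA hq)) h0).mul
    (hasDerivAt_line_y hD hb hq)
  refine (hasDerivAt_line_y hD ?_ hq).unique h1
  exact ((contDiffOn_const.mul (contDiffOn_pdx hD hB)).div (hB.sub hA)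
    fun q hq => sub_ne_zero.2 (hne q hq).symm).mul hb

/-- The derivative in `y` of the function `p` defined from `a`. -/
theorem pdy_p_of_pdy_a (hD : IsOpen D) (hA : ContDiffOn ℝ ∞ A D) (hB : ContDiffOn ℝ ∞ B D)
    (hne : ∀ q ∈ D, A q ≠ B q) (hBx : ∀ q ∈ D, pdx B q ≠ 0) (ha : ContDiffOn ℝ ∞ a D)
    (hp : ContDiffOn ℝ ∞ p D)
    (hay : ∀ q ∈ D, pdy a q = 2 * pdy A q / (A q - B q) * a q)
    (hpa : ∀ q ∈ D, p q = pdx B q * pdx a q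
      + 2 * (pdx (pdx B) q + pdx B q * (2 * pdx B q - pdx A q) / (A q - B q)) * a q
      - A q * B q * (B q - A q)) {q : ℝ × ℝ} (hq : q ∈ D) :
    pdy p q =
    (pdy (pdx B) q / pdx B q + 2 * pdy A q / (A q - B q)) * p q
    + 2 * (pdy (pdx (pdx B)) q - pdx (pdx B) q * pdy (pdx B) q / pdx B q
        + 2 * pdx B q * pdy (pdx B) q / (A q - B q)
        - pdx B q * (pdy A q * pdx B q + pdx A q * pdy B q - 2 * pdx B q * pdy B q)
          / (A q - B q) ^ 2) * a q
    - A q * B q * (A q - B q) * pdy (pdx B) q / pdx B q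
    + A q ^ 2 * pdy B q - 2 * A q * B q * pdy B q - B q ^ 2 * pdy A q := by
  obtain ⟨x, y⟩ := q
  have h0 := sub_ne_zero.2 (hne _ hq)
  have hB0 := hBx _ hq
  have hax := pdy_pdx_of_pdy_eq hD hA hB hne ha hay hq
  have hBx' := hasDerivAt_line_y hD (contDiffOn_pdx hD hB) hq
  have hA' := hasDerivAt_line_y hD hA hq
  have hB' := hasDerivAt_line_y hD hB hq
  -- Product rule along the vertical line for the expression of p in a; `h2` identifies the outcome
  -- with p_y by uniqueness of derivatives.
  have h1 := ((hBx'.mul (hasDerivAt_line_y hD (contDiffOn_pdx hD ha) hq)).add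
    ((((hasDerivAt_line_y hD (contDiffOn_pdx hD (contDiffOn_pdx hD hB)) hq).add
      ((hBx'.mul ((hBx'.const_mul 2).sub (hasDerivAt_line_y hD (contDiffOn_pdx hD hA) hq))).div
        (hA'.sub hB') h0)).const_mul 2).mul (hasDerivAt_line_y hD ha hq))).sub
    ((hA'.mul hB').mul (hB'.sub hA'))
  have h2 := (hasDerivAt_line_y hD hp hq).unique (h1.congr_of_eventuallyEq
    (Filter.eventually_of_mem ((hD.preimage (Continuous.prodMk_right x)).mem_nhds hq)
      fun s hs => hpa _ hs))
  rw [h2, hax, hay _ hq, hpa _ hq, pdx_pdy_comm hD hA hq]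
  simp only [Pi.sub_apply, Pi.mul_apply, Pi.add_apply, Pi.div_apply]
  field_simp
  ring

/-- The derivative in `x` of the function `p` defined from `b`. -/
theorem pdx_p_of_pdx_b (hD : IsOpen D) (hA : ContDiffOn ℝ ∞ A D) (hB : ContDiffOn ℝ ∞ B D)
    (hne : ∀ q ∈ D, A q ≠ B q) (hAy : ∀ q ∈ D, pdy A q ≠ 0) (hb : ContDiffOn ℝ ∞ b D)
    (hp : ContDiffOn ℝ ∞ p D)
    (hbx : ∀ q ∈ D, pdx b q = 2 * pdx B q / (B q - A q) * b q)
    (hpb : ∀ q ∈ D, p q = pdy A q * pdy b q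
      + 2 * (pdy (pdy A) q + pdy A q * (2 * pdy A q - pdy B q) / (B q - A q)) * b q
      - A q * B q * (A q - B q)) {q : ℝ × ℝ} (hq : q ∈ D) :
    pdx p q =
    (pdx (pdy A) q / pdy A q + 2 * pdx B q / (B q - A q)) * p q
    + 2 * (pdx (pdy (pdy A)) q - pdy (pdy A) q * pdx (pdy A) q / pdy A q
        + 2 * pdy A q * pdx (pdy A) q / (B q - A q)
        - pdy A q * (pdx B q * pdy A q + pdy B q * pdx A q - 2 * pdy A q * pdx A q)
          / (B q - A q) ^ 2) * b q
    - A q * B q * (B q - A q) * pdx (pdy A) q / pdy A q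
    + B q ^ 2 * pdx A q - 2 * A q * B q * pdx A q - A q ^ 2 * pdx B q := by
  obtain ⟨x, y⟩ := q
  have h0 := sub_ne_zero.2 (hne _ hq).symm
  have hA0 := hAy _ hq
  have hby := pdx_pdy_of_pdx_eq hD hA hB hne hb hbx hq
  have hAy' := hasDerivAt_line_x hD (contDiffOn_pdy hD hA) hq
  have hA' := hasDerivAt_line_x hD hA hq
  have hB' := hasDerivAt_line_x hD hB hq
  have h1 := ((hAy'.mul (hasDerivAt_line_x hD (contDiffOn_pdy hD hb) hq)).add
    ((((hasDerivAt_line_x hD (contDiffOn_pdy hD (contDiffOn_pdy hD hA)) hq).add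
      ((hAy'.mul ((hAy'.const_mul 2).sub (hasDerivAt_line_x hD (contDiffOn_pdy hD hB) hq))).div
        (hB'.sub hA') h0)).const_mul 2).mul (hasDerivAt_line_x hD hb hq))).sub
    ((hA'.mul hB').mul (hA'.sub hB'))
  have h2 := (hasDerivAt_line_x hD hp hq).unique (h1.congr_of_eventuallyEq
    (Filter.eventually_of_mem ((hD.preimage (Continuous.prodMk_left y)).mem_nhds hq)
      fun s hs => hpb _ hs))
  rw [h2, hby, hbx _ hq, hpb _ hq, pdx_pdy_comm hD hB hq]
  simp only [Pi.sub_apply, Pi.mul_apply, Pi.add_apply, Pi.div_apply]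
  field_simp
  ring

end Derivation

/-! ### Second derivatives of the immersion, Gauss's equation, and the total system. -/

namespace Realization

variable {D : Set (ℝ × ℝ)} {A B : ℝ × ℝ → ℝ} (r : Realization D A B) {q : ℝ × ℝ}

theorem inner_pdx_pdx_pdx (hD : IsOpen D) (hq : q ∈ D) :
    inner ℝ (pdx r.X q) (pdx (pdx r.X) q) = -(pdx r.a q / (2 * r.a q ^ 2)) := by
  have hd := differentiableAt_of_smooth hD (r.smooth_pdx_X hD) hq
  have h0 := (r.a_pos hq).ne'
  have h1 := pdx_inv (hd.inner ℝ hd) (by rw [r.inner_pdx_pdx]; exact inv_ne_zero h0)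
  have h2 : pdx r.a q = _ := h1
  rw [h2, pdx_inner hd hd, real_inner_comm (pdx r.X q), r.inner_pdx_pdx]
  field_simp
  ring

theorem inner_pdy_pdy_pdy (hD : IsOpen D) (hq : q ∈ D) :
    inner ℝ (pdy r.X q) (pdy (pdy r.X) q) = -(pdy r.b q / (2 * r.b q ^ 2)) := by
  have hd := differentiableAt_of_smooth hD (r.smooth_pdy_X hD) hq
  have h0 := (r.b_pos hq).ne'
  have h1 := pdy_inv (hd.inner ℝ hd) (by rw [r.inner_pdy_pdy]; exact inv_ne_zero h0)
  have h2 : pdy r.b q = _ := h1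
  rw [h2, pdy_inner hd hd, real_inner_comm (pdy r.X q), r.inner_pdy_pdy]
  field_simp
  ring

/-- Differentiate ⟨N, X_x⟩ = 0 in x and insert Weingarten's equation. -/
theorem inner_N_pdx_pdx (hD : IsOpen D) (hne : A q ≠ B q) (hq : q ∈ D) :
    inner ℝ (r.N q) (pdx (pdx r.X) q) = A q / r.a q := by
  have h1 := pdx_inner (differentiableAt_of_smooth hD r.smooth_N hq)
    (differentiableAt_of_smooth hD (r.smooth_pdx_X hD) hq)
  rw [pdx_congr hD (g := fun _ => (0 : ℝ)) (fun p hp => r.inner_N_pdx hp) hq, pdx_const,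
    r.pdx_N hD hne hq, inner_neg_left, real_inner_smul_left, r.inner_pdx_pdx] at h1
  rw [div_eq_mul_inv]
  linarith

theorem inner_N_pdy_pdy (hD : IsOpen D) (hne : A q ≠ B q) (hq : q ∈ D) :
    inner ℝ (r.N q) (pdy (pdy r.X) q) = B q / r.b q := by
  have h1 := pdy_inner (differentiableAt_of_smooth hD r.smooth_N hq)
    (differentiableAt_of_smooth hD (r.smooth_pdy_X hD) hq)
  rw [pdy_congr hD (g := fun _ => (0 : ℝ)) (fun p hp => r.inner_N_pdy hp) hq, pdy_const,
    r.pdy_N hD hne hq, inner_neg_left, real_inner_smul_left, r.inner_pdy_pdy] at h1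
  rw [div_eq_mul_inv]
  linarith

variable (hD : IsOpen D) (hA : ContDiffOn ℝ ∞ A D) (hB : ContDiffOn ℝ ∞ B D)
  (hne : ∀ q ∈ D, A q ≠ B q)
include hD hA hB hne

/-- Differentiating ⟨X_x, X_y⟩ = 0 in x reduces this to the known product ⟨X_x, X_xy⟩. -/
theorem inner_pdy_pdx_pdx (hq : q ∈ D) :
    inner ℝ (pdy r.X q) (pdx (pdx r.X) q) = pdy A q / (A q - B q) / r.a q := by
  have h1 := pdx_inner (differentiableAt_of_smooth hD (r.smooth_pdx_X hD) hq)
    (differentiableAt_of_smooth hD (r.smooth_pdy_X hD) hq)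
  rw [pdx_congr hD (g := fun _ => (0 : ℝ)) (fun p hp => r.inner_pdx_pdy (hne p hp) hp) hq,
    pdx_const, pdx_pdy_comm hD r.smooth_X hq, r.inner_pdx_mixed hD hA hB hne hq,
    real_inner_comm (pdy r.X q)] at h1
  linarith

theorem inner_pdx_pdy_pdy (hq : q ∈ D) :
    inner ℝ (pdx r.X q) (pdy (pdy r.X) q) = -(pdx B q / (A q - B q) / r.b q) := by
  have h1 := pdy_inner (differentiableAt_of_smooth hD (r.smooth_pdx_X hD) hq)
    (differentiableAt_of_smooth hD (r.smooth_pdy_X hD) hq)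
  rw [pdy_congr hD (g := fun _ => (0 : ℝ)) (fun p hp => r.inner_pdx_pdy (hne p hp) hp) hq,
    pdy_const, real_inner_comm (pdy r.X q) (pdy (pdx r.X) q),
    r.inner_pdy_mixed hD hA hB hne hq] at h1
  linarith

/-- Gauss's equation. -/
theorem gauss (hq : q ∈ D) : r.p q = pdy A q * pdy r.b q
    + 2 * (pdy (pdy A) q + pdy A q * (2 * pdy A q - pdy B q) / (B q - A q)) * r.b q
    - A q * B q * (A q - B q) := by
  have ha := r.smooth_a hD
  have hb := r.smooth_b hD
  have hXx := r.smooth_pdx_X hD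
  have hXy := r.smooth_pdy_X hD
  have hXxy := contDiffOn_pdy hD hXx
  -- The derivatives ⟨X_y, X_xx⟩_y and ⟨X_y, X_xy⟩_x share the third order term ⟨X_y, X_xxy⟩.
  -- Subtracting removes it and leaves ⟨X_yy, X_xx⟩ - |X_xy|², which is computed in the frame.
  have e1 := pdy_inner (differentiableAt_of_smooth hD hXy hq)
    (differentiableAt_of_smooth hD (contDiffOn_pdx hD hXx) hq)
  have e2 := pdx_inner (differentiableAt_of_smooth hD hXy hq)
    (differentiableAt_of_smooth hD hXxy hq)
  rw [pdy_congr hD (fun p hp => r.inner_pdy_pdx_pdx hD hA hB hne hp) hq,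
    r.inner_eq_sum_frame (hne q hq) hq (pdy (pdy r.X) q), r.inner_pdx_pdy_pdy hD hA hB hne hq,
    r.inner_pdx_pdx_pdx hD hq, r.inner_pdy_pdy_pdy hD hq, r.inner_pdy_pdx_pdx hD hA hB hne hq,
    r.inner_N_pdx_pdx hD (hne q hq) hq, r.inner_N_pdy_pdy hD (hne q hq) hq,
    ← pdx_pdy_comm hD hXx hq] at e1
  have hNW : inner ℝ (r.N q) (pdy (pdx r.X) q) = (0 : ℝ) := by
    rw [r.pdy_pdx_X hD hA hB hne hq, inner_sub_right, real_inner_smul_right,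
      real_inner_smul_right, r.inner_N_pdx hq, r.inner_N_pdy hq]
    ring
  rw [pdx_congr hD (fun p hp => r.inner_pdy_mixed hD hA hB hne hp) hq,
    pdx_pdy_comm hD r.smooth_X hq, r.inner_eq_sum_frame (hne q hq) hq (pdy (pdx r.X) q),
    r.inner_pdx_mixed hD hA hB hne hq, r.inner_pdy_mixed hD hA hB hne hq, hNW] at e2
  obtain ⟨x, y⟩ := q
  have h0 := sub_ne_zero.2 (hne _ hq)
  have ha0 := (r.a_pos hq).ne'
  have hb0 := (r.b_pos hq).ne'
  have hAB := hA.sub hB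
  have hAB0 : ∀ q ∈ D, A q - B q ≠ 0 := fun q hq => sub_ne_zero.2 (hne q hq)
  have d1 := (((hasDerivAt_line_y hD (contDiffOn_pdy hD hA) hq).div
    ((hasDerivAt_line_y hD hA hq).sub (hasDerivAt_line_y hD hB hq)) h0).div
      (hasDerivAt_line_y hD ha hq) ha0)
  have d1' := (hasDerivAt_line_y hD (((contDiffOn_pdy hD hA).div hAB hAB0).div ha
    fun q hq => (r.a_pos hq).ne') hq).unique d1
  have d2 := (((hasDerivAt_line_x hD (contDiffOn_pdx hD hB) hq).div
    ((hasDerivAt_line_x hD hA hq).sub (hasDerivAt_line_x hD hB hq)) h0).div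
      (hasDerivAt_line_x hD hb hq) hb0)
  have d2' := (hasDerivAt_line_x hD (((contDiffOn_pdx hD hB).div hAB hAB0).div hb
    fun q hq => (r.b_pos hq).ne') hq).unique d2
  simp only [Pi.sub_apply, Pi.div_apply] at d1' d2'
  have f1 := d1'.symm.trans e1
  have f2 := d2'.symm.trans e2
  rw [r.pdy_a hD hA hB hne hq] at f1
  rw [r.pdx_b hD hA hB hne hq, ← neg_sub (A (x, y))] at f2
  rw [p, ← neg_sub (A (x, y))]
  -- The factor -2ab(A - B) clears the denominators coming from a and b; this is what makes Gauss's
  -- equation affine in (a, b).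
  linear_combination (norm := skip)
    (-2 * r.a (x, y) * r.b (x, y) * (A (x, y) - B (x, y))) * (f1 - f2)
  field_simp
  ring

theorem smooth_p : ContDiffOn ℝ ∞ r.p D := by
  have hBx := contDiffOn_pdx hD hB
  have ha := r.smooth_a hD
  exact ((hBx.mul (contDiffOn_pdx hD ha)).add ((contDiffOn_const.mul ((contDiffOn_pdx hD hBx).add
    ((hBx.mul ((contDiffOn_const.mul hBx).sub (contDiffOn_pdx hD hA))).div (hA.sub hB)
      fun q hq => sub_ne_zero.2 (hne q hq)))).mul ha)).sub ((hA.mul hB).mul (hB.sub hA))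

/-- The functions `(a, b, p)` of a realization solve the total system. -/
theorem isTotalSolution (hAy : ∀ q ∈ D, pdy A q ≠ 0) (hBx : ∀ q ∈ D, pdx B q ≠ 0) :
    IsTotalSolution D A B r.a r.b r.p where
  smooth_a := r.smooth_a hD
  smooth_b := r.smooth_b hD
  smooth_p := r.smooth_p hD hA hB hne
  eq_a_y q hq := r.pdy_a hD hA hB hne hq
  eq_b_x q hq := r.pdx_b hD hA hB hne hq
  -- This is the definition of p solved for a_x; the equation for b_y is where Gauss is used.
  eq_a_x q hq := by
    have h0 := sub_ne_zero.2 (hne q hq)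
    have h1 := hBx q hq
    rw [p]
    field_simp
    ring
  eq_b_y q hq := by
    have h0 := sub_ne_zero.2 (hne q hq).symm
    have h1 := hAy q hq
    rw [r.gauss hD hA hB hne hq]
    field_simp
    ring
  eq_p_y q hq := pdy_p_of_pdy_a hD hA hB hne hBx (r.smooth_a hD) (r.smooth_p hD hA hB hne)
    (fun q hq => r.pdy_a hD hA hB hne hq) (fun q _ => rfl) hq
  eq_p_x q hq := pdx_p_of_pdx_b hD hA hB hne hAy (r.smooth_b hD) (r.smooth_p hD hA hB hne)
    (fun q hq => r.pdx_b hD hA hB hne hq) (fun q hq => r.gauss hD hA hB hne hq) hq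

end Realization

/-! ### The Gauss-Weingarten system for (X, X_x, X_y, N) and its flatness. -/

section FrameSystem

/-- The shape of the coefficient matrix of the `x`-derivatives of `(X, X_x, X_y, N)`. -/
def framePatternX (c₁ c₂ c₃ g h m : ℝ × ℝ → ℝ) : Fin 4 → Fin 4 → ℝ × ℝ → ℝ :=
  ![![0, 1, 0, 0], ![0, c₁, c₂, c₃], ![0, g, h, 0], ![0, m, 0, 0]]

/-- The shape of the coefficient matrix of the `y`-derivatives of `(X, X_x, X_y, N)`. -/
def framePatternY (d₁ d₂ d₃ g h n : ℝ × ℝ → ℝ) : Fin 4 → Fin 4 → ℝ × ℝ → ℝ :=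
  ![![0, 0, 1, 0], ![0, g, h, 0], ![0, d₁, d₂, d₃], ![0, 0, n, 0]]

/-- Of the sixteen entries of the flatness condition, eight vanish identically or agree for every
choice of coefficients: the first row, the first column, and the last diagonal entry. The hypotheses
are the other eight. -/
theorem framePattern_flat {c₁ c₂ c₃ d₁ d₂ d₃ g h m n : ℝ × ℝ → ℝ} {q : ℝ × ℝ}
    (e₁ : pdy c₁ q + (c₁ q * g q + c₂ q * d₁ q) = pdx g q + (g q * c₁ q + h q * g q))
    (e₂ : pdy c₂ q + (c₁ q * h q + c₂ q * d₂ q + c₃ q * n q)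
      = pdx h q + (g q * c₂ q + h q * h q))
    (e₃ : pdy c₃ q + c₂ q * d₃ q = g q * c₃ q)
    (e₄ : pdy g q + (g q * g q + h q * d₁ q)
      = pdx d₁ q + (d₁ q * c₁ q + d₂ q * g q + d₃ q * m q))
    (e₅ : pdy h q + (g q * h q + h q * d₂ q) = pdx d₂ q + (d₁ q * c₂ q + d₂ q * h q))
    (e₆ : h q * d₃ q = pdx d₃ q + d₁ q * c₃ q)
    (e₇ : pdy m q + m q * g q = n q * g q)
    (e₈ : m q * h q = pdx n q + n q * h q) (i j : Fin 4) :
    pdy (framePatternX c₁ c₂ c₃ g h m i j) q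
      + ∑ k, framePatternX c₁ c₂ c₃ g h m i k q * framePatternY d₁ d₂ d₃ g h n k j q
    = pdx (framePatternY d₁ d₂ d₃ g h n i j) q
      + ∑ k, framePatternY d₁ d₂ d₃ g h n i k q * framePatternX c₁ c₂ c₃ g h m k j q := by
  have z1 : pdx (0 : ℝ × ℝ → ℝ) q = 0 := pdx_const 0
  have z2 : pdy (0 : ℝ × ℝ → ℝ) q = 0 := pdy_const 0
  have z3 : pdx (1 : ℝ × ℝ → ℝ) q = 0 := pdx_const 1
  have z4 : pdy (1 : ℝ × ℝ → ℝ) q = 0 := pdy_const 1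
  fin_cases i <;> fin_cases j <;>
    simp [framePatternX, framePatternY, Fin.sum_univ_four, z1, z2, z3, z4] <;> assumption

variable (A B a b : ℝ × ℝ → ℝ)

/-- Coefficients of the `x`-derivatives of `(X, X_x, X_y, N)` for an immersion with first
fundamental form `dx² / a + dy² / b` and principal curvatures `A`, `B`. -/
noncomputable def frameX : Fin 4 → Fin 4 → ℝ × ℝ → ℝ :=
  framePatternX (fun q => -(pdx a q / (2 * a q))) (fun q => pdy A q / (A q - B q) * b q / a q)
    (fun q => A q / a q) (fun q => -(pdy A q / (A q - B q))) (fun q => pdx B q / (A q - B q))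
    (fun q => -A q)

/-- Coefficients of the `y`-derivatives of `(X, X_x, X_y, N)` for an immersion with first
fundamental form `dx² / a + dy² / b` and principal curvatures `A`, `B`. -/
noncomputable def frameY : Fin 4 → Fin 4 → ℝ × ℝ → ℝ :=
  framePatternY (fun q => -(pdx B q / (A q - B q) * a q / b q))
    (fun q => -(pdy b q / (2 * b q))) (fun q => B q / b q)
    (fun q => -(pdy A q / (A q - B q))) (fun q => pdx B q / (A q - B q)) (fun q => -B q)

variable {A B a b} {D : Set (ℝ × ℝ)}

theorem contDiffOn_frameX (hD : IsOpen D) (hA : ContDiffOn ℝ ∞ A D) (hB : ContDiffOn ℝ ∞ B D)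
    (hne : ∀ q ∈ D, A q - B q ≠ 0) (ha : ContDiffOn ℝ ∞ a D) (hb : ContDiffOn ℝ ∞ b D)
    (ha0 : ∀ q ∈ D, a q ≠ 0) (i j : Fin 4) : ContDiffOn ℝ ∞ (frameX A B a b i j) D := by
  have k1 := (contDiffOn_pdy hD hA).div (hA.sub hB) hne
  have k2 := (contDiffOn_pdx hD hB).div (hA.sub hB) hne
  have k3 := ((contDiffOn_pdx hD ha).div (contDiffOn_const.mul ha)
    fun q hq => mul_ne_zero two_ne_zero (ha0 q hq)).neg
  have k4 := (k1.mul hb).div ha ha0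
  have k5 := hA.div ha ha0
  have k6 : ContDiffOn ℝ ∞ (0 : ℝ × ℝ → ℝ) D := contDiffOn_const
  have k7 : ContDiffOn ℝ ∞ (1 : ℝ × ℝ → ℝ) D := contDiffOn_const
  fin_cases i <;> fin_cases j <;>
    first | exact k6 | exact k7 | exact k3 | exact k4 | exact k5 | exact k1.neg | exact k2 |
      exact hA.neg

theorem contDiffOn_frameY (hD : IsOpen D) (hA : ContDiffOn ℝ ∞ A D) (hB : ContDiffOn ℝ ∞ B D)
    (hne : ∀ q ∈ D, A q - B q ≠ 0) (ha : ContDiffOn ℝ ∞ a D) (hb : ContDiffOn ℝ ∞ b D)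
    (hb0 : ∀ q ∈ D, b q ≠ 0) (i j : Fin 4) : ContDiffOn ℝ ∞ (frameY A B a b i j) D := by
  have k1 := (contDiffOn_pdy hD hA).div (hA.sub hB) hne
  have k2 := (contDiffOn_pdx hD hB).div (hA.sub hB) hne
  have k3 := ((contDiffOn_pdy hD hb).div (contDiffOn_const.mul hb)
    fun q hq => mul_ne_zero two_ne_zero (hb0 q hq)).neg
  have k4 := ((k2.mul ha).div hb hb0).neg
  have k5 := hB.div hb hb0
  have k6 : ContDiffOn ℝ ∞ (0 : ℝ × ℝ → ℝ) D := contDiffOn_const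
  have k7 : ContDiffOn ℝ ∞ (1 : ℝ × ℝ → ℝ) D := contDiffOn_const
  fin_cases i <;> fin_cases j <;>
    first | exact k6 | exact k7 | exact k3 | exact k4 | exact k5 | exact k1.neg | exact k2 |
      exact hB.neg

/-- The frame system is flat when the equations of Gauss and Codazzi hold. -/
theorem frame_flat (hD : IsOpen D) (hA : ContDiffOn ℝ ∞ A D) (hB : ContDiffOn ℝ ∞ B D)
    (hne : ∀ q ∈ D, A q ≠ B q) (ha : ContDiffOn ℝ ∞ a D) (hb : ContDiffOn ℝ ∞ b D)
    (ha0 : ∀ q ∈ D, a q ≠ 0) (hb0 : ∀ q ∈ D, b q ≠ 0)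
    (hay : ∀ q ∈ D, pdy a q = 2 * pdy A q / (A q - B q) * a q)
    (hbx : ∀ q ∈ D, pdx b q = 2 * pdx B q / (B q - A q) * b q)
    (hgauss : ∀ q ∈ D, pdx B q * pdx a q
      + 2 * (pdx (pdx B) q + pdx B q * (2 * pdx B q - pdx A q) / (A q - B q)) * a q
      - A q * B q * (B q - A q) = pdy A q * pdy b q
      + 2 * (pdy (pdy A) q + pdy A q * (2 * pdy A q - pdy B q) / (B q - A q)) * b q
      - A q * B q * (A q - B q)) {q : ℝ × ℝ} (hq : q ∈ D) (i j : Fin 4) :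
    pdy (frameX A B a b i j) q + ∑ k, frameX A B a b i k q * frameY A B a b k j q
      = pdx (frameY A B a b i j) q + ∑ k, frameY A B a b i k q * frameX A B a b k j q := by
  obtain ⟨x, y⟩ := q
  have h0 := sub_ne_zero.2 (hne _ hq)
  have h0' : ∀ q ∈ D, A q - B q ≠ 0 := fun q hq => sub_ne_zero.2 (hne q hq)
  have a0 := ha0 _ hq
  have b0 := hb0 _ hq
  have hG := hgauss _ hq
  have hax := pdy_pdx_of_pdy_eq hD hA hB hne ha hay hq
  have hby := pdx_pdy_of_pdx_eq hD hA hB hne hb hbx hq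
  have hay' := hay _ hq
  have hbx' := hbx _ hq
  rw [← neg_sub (A (x, y)) (B (x, y))] at hG hby hbx'
  have sAy := contDiffOn_pdy hD hA
  have sBx := contDiffOn_pdx hD hB
  have sg := sAy.div (hA.sub hB) h0'
  have sh := sBx.div (hA.sub hB) h0'
  have dax := hasDerivAt_line_x hD ha hq
  have day := hasDerivAt_line_y hD ha hq
  have dbx := hasDerivAt_line_x hD hb hq
  have dby := hasDerivAt_line_y hD hb hq
  have lgx := (hasDerivAt_line_x hD sAy hq).div
    ((hasDerivAt_line_x hD hA hq).sub (hasDerivAt_line_x hD hB hq)) h0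
  have lgy := (hasDerivAt_line_y hD sAy hq).div
    ((hasDerivAt_line_y hD hA hq).sub (hasDerivAt_line_y hD hB hq)) h0
  have lhx := (hasDerivAt_line_x hD sBx hq).div
    ((hasDerivAt_line_x hD hA hq).sub (hasDerivAt_line_x hD hB hq)) h0
  have lhy := (hasDerivAt_line_y hD sBx hq).div
    ((hasDerivAt_line_y hD hA hq).sub (hasDerivAt_line_y hD hB hq)) h0
  have gx := (hasDerivAt_line_x hD sg.neg hq).unique lgx.neg
  have gy := (hasDerivAt_line_y hD sg.neg hq).unique lgy.neg
  have hx := (hasDerivAt_line_x hD sh hq).unique lhx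
  have hy := (hasDerivAt_line_y hD sh hq).unique lhy
  have c1 := (hasDerivAt_line_y hD ((contDiffOn_pdx hD ha).div (contDiffOn_const.mul ha)
    fun q hq => mul_ne_zero two_ne_zero (ha0 q hq)).neg hq).unique
      (((hasDerivAt_line_y hD (contDiffOn_pdx hD ha) hq).div (day.const_mul 2)
        (mul_ne_zero two_ne_zero a0)).neg)
  have d2 := (hasDerivAt_line_x hD ((contDiffOn_pdy hD hb).div (contDiffOn_const.mul hb)
    fun q hq => mul_ne_zero two_ne_zero (hb0 q hq)).neg hq).unique
      (((hasDerivAt_line_x hD (contDiffOn_pdy hD hb) hq).div (dbx.const_mul 2)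
        (mul_ne_zero two_ne_zero b0)).neg)
  have c2 := (hasDerivAt_line_y hD ((sg.mul hb).div ha ha0) hq).unique ((lgy.mul dby).div day a0)
  have d1 := (hasDerivAt_line_x hD ((sh.mul ha).div hb hb0).neg hq).unique
    ((lhx.mul dax).div dbx b0).neg
  have c3 := (hasDerivAt_line_y hD (hA.div ha ha0) hq).unique
    ((hasDerivAt_line_y hD hA hq).div day a0)
  have d3 := (hasDerivAt_line_x hD (hB.div hb hb0) hq).unique
    ((hasDerivAt_line_x hD hB hq).div dbx b0)
  simp only [Pi.sub_apply, Pi.mul_apply, Pi.div_apply] at gx gy hx hy c1 c2 c3 d1 d2 d3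
  refine framePattern_flat ?_ ?_ ?_ ?_ ?_ ?_ ?_ ?_ i j
  · refine (congrArg (· + _) c1).trans ((congrArg (· + _) gx).trans ?_).symm
    rw [hax, hay']
    field_simp
    ring
  -- Gauss's equation is used in this entry and in the one for g_y; the other six need at most the
  -- Codazzi equations and their derivatives.
  · refine (congrArg (· + _) c2).trans ((congrArg (· + _) hx).trans ?_).symm
    rw [hay']
    linear_combination (norm := skip) (1 / (2 * a (x, y) * (A (x, y) - B (x, y)))) * hG
    field_simp
    ring
  · refine (congrArg (· + _) c3).trans ?_
    rw [hay']
    field_simp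
    ring
  · refine (congrArg (· + _) gy).trans ((congrArg (· + _) d1).trans ?_).symm
    rw [hbx']
    linear_combination (norm := skip) (-1 / (2 * b (x, y) * (A (x, y) - B (x, y)))) * hG
    field_simp
    ring
  · refine (congrArg (· + _) hy).trans ((congrArg (· + _) d2).trans ?_).symm
    rw [hby, hbx']
    field_simp
    ring
  · refine ((congrArg (· + _) d3).trans ?_).symm
    rw [hbx']
    field_simp
    ring
  · rw [pdy_neg]
    field_simp
    ring
  · rw [pdx_neg]
    field_simp
    ring

end FrameSystem

/-- Two orthogonal frames with the same lengths differ by a linear isometry. -/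
theorem exists_linearIsometryEquiv_of_gram_eq {f f' : Fin 3 → E3} {c : Fin 3 → ℝ}
    (hc : ∀ i, c i ≠ 0) (h : ∀ i j, inner ℝ (f i) (f j) = if i = j then (c i)⁻¹ else 0)
    (h' : ∀ i j, inner ℝ (f' i) (f' j) = if i = j then (c i)⁻¹ else 0) :
    ∃ L : E3 ≃ₗᵢ[ℝ] E3, ∀ i, L (f i) = f' i := by
  -- Expand z in the frame f and use the same coefficients in f'. By `key` the norm depends only on
  -- the coefficients and c, so T is isometric.
  let T : E3 →ₗ[ℝ] E3 := ∑ i, LinearMap.smulRight (c i • (innerₗ E3 (f i))) (f' i)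
  have hT : ∀ z, T z = ∑ i, (c i * inner ℝ (f i) z) • f' i := fun z => by
    simp [T, LinearMap.sum_apply]
  have key : ∀ (g : Fin 3 → E3), (∀ i j, inner ℝ (g i) (g j) = if i = j then (c i)⁻¹ else 0) →
      ∀ t : Fin 3 → ℝ, inner ℝ (∑ i, (c i * t i) • g i) (∑ i, (c i * t i) • g i)
        = ∑ i, c i * t i ^ 2 := by
    intro g hg t
    simp only [sum_inner, inner_sum, real_inner_smul_left, real_inner_smul_right, hg]
    refine Finset.sum_congr rfl fun i _ => ?_
    simp only [mul_ite, mul_zero, Finset.sum_ite_eq', Finset.mem_univ, if_true]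
    have := hc i
    field_simp
  have hnorm : ∀ z, ‖T z‖ = ‖z‖ := by
    intro z
    have h1 : inner ℝ (T z) (T z) = inner ℝ z z := by
      conv_rhs => rw [frame_expansion hc h z]
      rw [hT, key f' h', key f h]
    rw [real_inner_self_eq_norm_sq, real_inner_self_eq_norm_sq] at h1
    exact (pow_left_inj₀ (norm_nonneg _) (norm_nonneg _) two_ne_zero).1 h1
  refine ⟨(LinearIsometry.mk T hnorm).toLinearIsometryEquiv rfl, fun j => ?_⟩
  have : T (f j) = f' j := by
    rw [hT]
    simp [h, hc j]
  exact this

section FrameSums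

variable {A B a b : ℝ × ℝ → ℝ} (q : ℝ × ℝ) (Y : Fin 4 → E3)

theorem frameX_sum : (∑ j, frameX A B a b 0 j q • Y j = Y 1) ∧
    (∑ j, frameX A B a b 1 j q • Y j = -(pdx a q / (2 * a q)) • Y 1
      + (pdy A q / (A q - B q) * b q / a q) • Y 2 + (A q / a q) • Y 3) ∧
    (∑ j, frameX A B a b 2 j q • Y j = -(pdy A q / (A q - B q)) • Y 1
      + (pdx B q / (A q - B q)) • Y 2) ∧
    (∑ j, frameX A B a b 3 j q • Y j = -A q • Y 1) := by
  simp [frameX, framePatternX, Fin.sum_univ_four]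

theorem frameY_sum : (∑ j, frameY A B a b 0 j q • Y j = Y 2) ∧
    (∑ j, frameY A B a b 1 j q • Y j = -(pdy A q / (A q - B q)) • Y 1
      + (pdx B q / (A q - B q)) • Y 2) ∧
    (∑ j, frameY A B a b 2 j q • Y j = -(pdx B q / (A q - B q) * a q / b q) • Y 1
      + -(pdy b q / (2 * b q)) • Y 2 + (B q / b q) • Y 3) ∧
    (∑ j, frameY A B a b 3 j q • Y j = -B q • Y 2) := by
  simp [frameY, framePatternY, Fin.sum_univ_four]

end FrameSums

/-! ### Bonnet's theorem, existence. -/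

section Existence

variable {I J : Set ℝ} {A B a b : ℝ × ℝ → ℝ}

/-- A positive solution of the equations of Gauss and Codazzi comes from a realization. -/
theorem exists_realization (hI : IsOpen I) [I.OrdConnected] (hJ : IsOpen J) [J.OrdConnected]
    (hA : ContDiffOn ℝ ∞ A (I ×ˢ J)) (hB : ContDiffOn ℝ ∞ B (I ×ˢ J))
    (hne : ∀ q ∈ I ×ˢ J, A q ≠ B q) (ha : ContDiffOn ℝ ∞ a (I ×ˢ J))
    (hb : ContDiffOn ℝ ∞ b (I ×ˢ J)) (ha0 : ∀ q ∈ I ×ˢ J, 0 < a q) (hb0 : ∀ q ∈ I ×ˢ J, 0 < b q)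
    (hay : ∀ q ∈ I ×ˢ J, pdy a q = 2 * pdy A q / (A q - B q) * a q)
    (hbx : ∀ q ∈ I ×ˢ J, pdx b q = 2 * pdx B q / (B q - A q) * b q)
    (hgauss : ∀ q ∈ I ×ˢ J, pdx B q * pdx a q
      + 2 * (pdx (pdx B) q + pdx B q * (2 * pdx B q - pdx A q) / (A q - B q)) * a q
      - A q * B q * (B q - A q) = pdy A q * pdy b q
      + 2 * (pdy (pdy A) q + pdy A q * (2 * pdy A q - pdy B q) / (B q - A q)) * b q
      - A q * B q * (A q - B q)) {q₀ : ℝ × ℝ} (hq₀ : q₀ ∈ I ×ˢ J) :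
    ∃ r : Realization (I ×ˢ J) A B, ∀ q ∈ I ×ˢ J, r.a q = a q ∧ r.b q = b q := by
  have hD : IsOpen (I ×ˢ J) := hI.prod hJ
  have hsub : ∀ q ∈ I ×ˢ J, A q - B q ≠ 0 := fun q hq => sub_ne_zero.2 (hne q hq)
  have ha1 : ∀ q ∈ I ×ˢ J, a q ≠ 0 := fun q hq => (ha0 q hq).ne'
  have hb1 : ∀ q ∈ I ×ˢ J, b q ≠ 0 := fun q hq => (hb0 q hq).ne'
  let e : Fin 3 → E3 := fun i => EuclideanSpace.single i 1
  -- Integrate the frame system from the origin with the standard basis rescaled to the prescribed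
  -- lengths 1/√a, 1/√b, 1 at q₀.
  obtain ⟨Y, hY0, hY, hYx, hYy⟩ := exists_tuple (E := E3) hI hJ
    (contDiffOn_frameX hD hA hB hsub ha hb ha1) (contDiffOn_frameY hD hA hB hsub ha hb hb1)
    (fun q hq i j => frame_flat hD hA hB hne ha hb ha1 hb1 hay hbx hgauss hq i j) hq₀
    ![0, (√(a q₀))⁻¹ • e 0, (√(b q₀))⁻¹ • e 1, e 2]
  have x0 : ∀ q ∈ I ×ˢ J, pdx (Y 0) q = Y 1 q := fun q hq =>
    (hYx 0 q hq).trans (frameX_sum _ _).1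
  have x1 := fun q hq => (hYx 1 q hq).trans (frameX_sum q (fun j => Y j q)).2.1
  have x2 := fun q hq => (hYx 2 q hq).trans (frameX_sum q (fun j => Y j q)).2.2.1
  have x3 := fun q hq => (hYx 3 q hq).trans (frameX_sum q (fun j => Y j q)).2.2.2
  have y0 : ∀ q ∈ I ×ˢ J, pdy (Y 0) q = Y 2 q := fun q hq =>
    (hYy 0 q hq).trans (frameY_sum _ _).1
  have y1 := fun q hq => (hYy 1 q hq).trans (frameY_sum q (fun j => Y j q)).2.1
  have y2 := fun q hq => (hYy 2 q hq).trans (frameY_sum q (fun j => Y j q)).2.2.1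
  have y3 := fun q hq => (hYy 3 q hq).trans (frameY_sum q (fun j => Y j q)).2.2.2
  have hgram₀ : ∀ i j : Fin 3, inner ℝ (![Y 1 q₀, Y 2 q₀, Y 3 q₀] i) (![Y 1 q₀, Y 2 q₀, Y 3 q₀] j)
      = if i = j then (![a q₀, b q₀, 1] i)⁻¹ else 0 := by
    have hs : ∀ i j : Fin 3, inner ℝ (e i) (e j) = if i = j then (1 : ℝ) else 0 := by
      intro i j
      simp [e, EuclideanSpace.inner_single_left]
    have ra := Real.mul_self_sqrt (ha0 q₀ hq₀).le
    have rb := Real.mul_self_sqrt (hb0 q₀ hq₀).le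
    have g1 : Y 1 q₀ = (√(a q₀))⁻¹ • e 0 := hY0 1
    have g2 : Y 2 q₀ = (√(b q₀))⁻¹ • e 1 := hY0 2
    have g3 : Y 3 q₀ = e 2 := hY0 3
    rw [g1, g2, g3]
    refine gram_of_orthogonal ?_ ?_ ?_ ?_ ?_ ?_
    · rw [real_inner_smul_left, real_inner_smul_right, hs, if_pos rfl, mul_one, ← mul_inv, ra]
    · rw [real_inner_smul_left, real_inner_smul_right, hs, if_pos rfl, mul_one, ← mul_inv, rb]
    all_goals simp [real_inner_smul_left, real_inner_smul_right, hs, -inner_self_eq_norm_sq_to_K]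
  have hc : ∀ q ∈ I ×ˢ J, ∀ i, ![a q, b q, 1] i ≠ 0 := by
    intro q hq i
    fin_cases i <;> simp [ha1 q hq, hb1 q hq]
  have hdY : ∀ i, ∀ q ∈ I ×ˢ J, ∀ k : Fin 3, DifferentiableAt ℝ (fun q => Y i q k) q :=
    fun i q hq k => (EuclideanSpace.proj k : E3 →L[ℝ] ℝ).differentiableAt.comp q
      (differentiableAt_of_smooth hD (hY i) hq)
  have hpx : ∀ i, ∀ q ∈ I ×ˢ J, ∀ k : Fin 3, pdx (fun q => Y i q k) q = pdx (Y i) q k :=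
    fun i q hq k => pdx_clm (EuclideanSpace.proj k : E3 →L[ℝ] ℝ)
      (differentiableAt_of_smooth hD (hY i) hq)
  have hpy : ∀ i, ∀ q ∈ I ×ˢ J, ∀ k : Fin 3, pdy (fun q => Y i q k) q = pdy (Y i) q k :=
    fun i q hq k => pdy_clm (EuclideanSpace.proj k : E3 →L[ℝ] ℝ)
      (differentiableAt_of_smooth hD (hY i) hq)
  have hda : ∀ q ∈ I ×ˢ J, DifferentiableAt ℝ a q := fun q hq => differentiableAt_of_smooth hD ha hq
  have hdb : ∀ q ∈ I ×ˢ J, DifferentiableAt ℝ b q := fun q hq => differentiableAt_of_smooth hD hb hq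
  -- Rather than propagate the Gram matrix, whose entries vary, use its dual a Y₁⊗Y₁ + b Y₂⊗Y₂ +
  -- Y₃⊗Y₃: its derivative is zero by the frame system and the equations for a_y and b_x.
  -- `gram_eq_iff` translates back.
  have hdual : ∀ q ∈ I ×ˢ J, ∀ k l : Fin 3,
      a q * (Y 1 q k * Y 1 q l) + b q * (Y 2 q k * Y 2 q l) + Y 3 q k * Y 3 q l
        = if k = l then 1 else 0 := by
    intro q hq k l
    have h1 := (gram_eq_iff _ _ (hc q₀ hq₀)).1 hgram₀ k l
    simp only [Fin.sum_univ_three, Matrix.cons_val_zero, Matrix.cons_val_one, Matrix.cons_val,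
      one_mul] at h1
    rw [← h1]
    have d1 : ∀ q ∈ I ×ˢ J, ∀ i, DifferentiableAt ℝ (fun q => Y i q k * Y i q l) q :=
      fun q hq i => (hdY i q hq k).mul (hdY i q hq l)
    have hdiff : ∀ q ∈ I ×ˢ J, DifferentiableAt ℝ (fun q => a q * (Y 1 q k * Y 1 q l)
        + b q * (Y 2 q k * Y 2 q l) + Y 3 q k * Y 3 q l) q := fun q hq =>
      (((hda q hq).mul (d1 q hq 1)).add ((hdb q hq).mul (d1 q hq 2))).add (d1 q hq 3)
    refine hD.is_const_of_fderiv_eq_zero (𝕜 := ℝ) (f := fun q => a q * (Y 1 q k * Y 1 q l)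
        + b q * (Y 2 q k * Y 2 q l) + Y 3 q k * Y 3 q l)
      ((Set.OrdConnected.isPreconnected ‹_›).prod (Set.OrdConnected.isPreconnected ‹_›))
      (fun q hq => (hdiff q hq).differentiableWithinAt) ?_ hq hq₀
    intro q hq
    have A0 := hsub q hq
    have a1 := ha1 q hq
    have b1 := hb1 q hq
    have hx : pdx (fun q => a q * (Y 1 q k * Y 1 q l) + b q * (Y 2 q k * Y 2 q l)
        + Y 3 q k * Y 3 q l) q = 0 := by
      rw [pdx_add (((hda q hq).fun_mul (d1 q hq 1)).fun_add ((hdb q hq).fun_mul (d1 q hq 2)))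
          (d1 q hq 3),
        pdx_add ((hda q hq).fun_mul (d1 q hq 1)) ((hdb q hq).fun_mul (d1 q hq 2)),
        pdx_mul (hda q hq) (d1 q hq 1), pdx_mul (hdb q hq) (d1 q hq 2),
        pdx_mul (hdY 1 q hq k) (hdY 1 q hq l), pdx_mul (hdY 2 q hq k) (hdY 2 q hq l),
        pdx_mul (hdY 3 q hq k) (hdY 3 q hq l)]
      simp only [hpx _ q hq, x1 q hq, x2 q hq, x3 q hq, PiLp.add_apply, PiLp.smul_apply,
        smul_eq_mul, hbx q hq]
      rw [← neg_sub (A q)]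
      field_simp
      ring
    have hy : pdy (fun q => a q * (Y 1 q k * Y 1 q l) + b q * (Y 2 q k * Y 2 q l)
        + Y 3 q k * Y 3 q l) q = 0 := by
      rw [pdy_add (((hda q hq).fun_mul (d1 q hq 1)).fun_add ((hdb q hq).fun_mul (d1 q hq 2)))
          (d1 q hq 3),
        pdy_add ((hda q hq).fun_mul (d1 q hq 1)) ((hdb q hq).fun_mul (d1 q hq 2)),
        pdy_mul (hda q hq) (d1 q hq 1), pdy_mul (hdb q hq) (d1 q hq 2),
        pdy_mul (hdY 1 q hq k) (hdY 1 q hq l), pdy_mul (hdY 2 q hq k) (hdY 2 q hq l),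
        pdy_mul (hdY 3 q hq k) (hdY 3 q hq l)]
      simp only [hpy _ q hq, y1 q hq, y2 q hq, y3 q hq, PiLp.add_apply, PiLp.smul_apply,
        smul_eq_mul, hay q hq]
      field_simp
      ring
    refine ContinuousLinearMap.ext fun v => ?_
    rw [fderiv_eq_pd, hx, hy, smul_zero, smul_zero, add_zero]
    rfl
  have hgram : ∀ q ∈ I ×ˢ J, ∀ i j : Fin 3,
      inner ℝ (![Y 1 q, Y 2 q, Y 3 q] i) (![Y 1 q, Y 2 q, Y 3 q] j)
        = if i = j then (![a q, b q, 1] i)⁻¹ else 0 := fun q hq =>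
    (gram_eq_iff _ _ (hc q hq)).2 fun k l => by
      simpa [Fin.sum_univ_three] using hdual q hq k l
  have huu : ∀ q ∈ I ×ˢ J, inner ℝ (Y 1 q) (Y 1 q) = (a q)⁻¹ := fun q hq => hgram q hq 0 0
  have hvv : ∀ q ∈ I ×ˢ J, inner ℝ (Y 2 q) (Y 2 q) = (b q)⁻¹ := fun q hq => hgram q hq 1 1
  have hNN : ∀ q ∈ I ×ˢ J, inner ℝ (Y 3 q) (Y 3 q) = (1 : ℝ) := fun q hq =>
    (hgram q hq 2 2).trans inv_one
  have huv : ∀ q ∈ I ×ˢ J, inner ℝ (Y 1 q) (Y 2 q) = (0 : ℝ) := fun q hq => hgram q hq 0 1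
  have hvu : ∀ q ∈ I ×ˢ J, inner ℝ (Y 2 q) (Y 1 q) = (0 : ℝ) := fun q hq => hgram q hq 1 0
  have hNu : ∀ q ∈ I ×ˢ J, inner ℝ (Y 3 q) (Y 1 q) = (0 : ℝ) := fun q hq => hgram q hq 2 0
  have hNv : ∀ q ∈ I ×ˢ J, inner ℝ (Y 3 q) (Y 2 q) = (0 : ℝ) := fun q hq => hgram q hq 2 1
  have hX : ∀ q ∈ I ×ˢ J, ∀ v : ℝ × ℝ, fderiv ℝ (Y 0) q v = v.1 • Y 1 q + v.2 • Y 2 q :=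
    fun q hq v => by rw [fderiv_eq_pd, x0 q hq, y0 q hq]
  have hN : ∀ q ∈ I ×ˢ J, ∀ v : ℝ × ℝ, fderiv ℝ (Y 3) q v
      = v.1 • (-A q • Y 1 q) + v.2 • (-B q • Y 2 q) :=
    fun q hq v => by rw [fderiv_eq_pd, x3 q hq, y3 q hq]
  refine ⟨⟨Y 0, Y 3, hY 0, hY 3, fun q hq => ?_, fun q hq => ?_, fun q hq v => ?_,
    fun q hq v w => ?_, fun q hq v w => ?_⟩, fun q hq => ⟨?_, ?_⟩⟩
  · rw [injective_iff_map_eq_zero]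
    intro v hv
    rw [hX q hq] at hv
    have h1 := congrArg (fun z => inner ℝ (Y 1 q) z) hv
    have h2 := congrArg (fun z => inner ℝ (Y 2 q) z) hv
    simp only [inner_add_right, real_inner_smul_right, huu q hq, huv q hq, hvu q hq, hvv q hq,
      inner_zero_right, mul_zero, add_zero, zero_add, mul_eq_zero, inv_eq_zero, ha1 q hq, hb1 q hq,
      or_false] at h1 h2
    exact Prod.ext h1 h2
  · have := hNN q hq
    rw [real_inner_self_eq_norm_sq] at this
    exact (pow_eq_one_iff_of_nonneg (norm_nonneg _) two_ne_zero).1 this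
  · simp only [hX q hq, inner_add_right, real_inner_smul_right, hNu q hq, hNv q hq, mul_zero,
      add_zero]
  · simp only [secondForm, firstForm, diagOp, hX q hq, hN q hq, inner_add_right, inner_add_left,
      real_inner_smul_left, real_inner_smul_right, huu q hq, huv q hq, hvu q hq, hvv q hq]
    ring
  · simp only [secondForm, firstForm, diagOp, hX q hq, hN q hq, inner_add_right, inner_add_left,
      real_inner_smul_left, real_inner_smul_right, huu q hq, huv q hq, hvu q hq, hvv q hq]
    ring
  · change (inner ℝ (pdx (Y 0) q) (pdx (Y 0) q))⁻¹ = a q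
    rw [x0 q hq, huu q hq, inv_inv]
  · change (inner ℝ (pdy (Y 0) q) (pdy (Y 0) q))⁻¹ = b q
    rw [y0 q hq, hvv q hq, inv_inv]

end Existence

/-! ### Bonnet's theorem, uniqueness: the pair (a, b) determines the congruence class. -/

namespace Realization

section Congruence

variable {D : Set (ℝ × ℝ)} {A B : ℝ × ℝ → ℝ} {q : ℝ × ℝ}

theorem Congruent.fderiv_eq {r s : Realization D A B} (hD : IsOpen D) {φ : E3 ≃ᵃⁱ[ℝ] E3}
    (h : ∀ q ∈ D, s.X q = φ (r.X q) ∧ s.N q = φ.linearIsometryEquiv (r.N q)) (hq : q ∈ D)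
    (v : ℝ × ℝ) : fderiv ℝ s.X q v = φ.linearIsometryEquiv (fderiv ℝ r.X q v) := by
  have hφ : ∀ z : E3, φ z = φ.linearIsometryEquiv z + φ 0 := fun z => by
    simpa using φ.map_vadd 0 z
  have h1 : s.X =ᶠ[𝓝 q] fun q => φ.linearIsometryEquiv (r.X q) + φ 0 :=
    Filter.eventually_of_mem (hD.mem_nhds hq) fun p hp => ((h p hp).1).trans (hφ _)
  have hd := (differentiableAt_of_smooth hD r.smooth_X hq).hasFDerivAt
  have h2 := ((φ.linearIsometryEquiv.toContinuousLinearEquiv.hasFDerivAt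
    (x := r.X q)).comp q hd).add_const (φ 0)
  have h3 : HasFDerivAt (fun q => φ.linearIsometryEquiv (r.X q) + φ 0) _ q := h2
  rw [h1.fderiv_eq, h3.fderiv]
  rfl

theorem Congruent.a_eq_and_b_eq {r s : Realization D A B} (hD : IsOpen D) (h : Congruent r s)
    (hq : q ∈ D) : r.a q = s.a q ∧ r.b q = s.b q := by
  obtain ⟨φ, h⟩ := h
  constructor
  · rw [a, a, firstForm, firstForm, Congruent.fderiv_eq hD h hq, LinearIsometryEquiv.inner_map_map]
  · rw [b, b, firstForm, firstForm, Congruent.fderiv_eq hD h hq, LinearIsometryEquiv.inner_map_map]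

/-- Besides A and B, only a and a_x enter p, and D is open. -/
theorem p_eq_of_a_eq (hD : IsOpen D) {r s : Realization D A B} (h : ∀ q ∈ D, r.a q = s.a q)
    (hq : q ∈ D) : r.p q = s.p q := by
  rw [p, p, pdx_congr hD h hq, h q hq]

/-- The immersion, its partial derivatives and its unit normal. -/
noncomputable def frameTuple (r : Realization D A B) : Fin 4 → ℝ × ℝ → E3 :=
  ![r.X, pdx r.X, pdy r.X, r.N]

theorem smooth_frameTuple (r : Realization D A B) (hD : IsOpen D) (i : Fin 4) :
    ContDiffOn ℝ ∞ (r.frameTuple i) D := by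
  fin_cases i
  · exact r.smooth_X
  · exact r.smooth_pdx_X hD
  · exact r.smooth_pdy_X hD
  · exact r.smooth_N

variable (r : Realization D A B) (hD : IsOpen D) (hA : ContDiffOn ℝ ∞ A D)
  (hB : ContDiffOn ℝ ∞ B D) (hne : ∀ q ∈ D, A q ≠ B q)
include hD hA hB hne

/-- The coefficients in `frameX` are the components of X_xx, X_xy and N_x in the frame, read off
from the inner products computed above. -/
theorem pdx_frameTuple (hq : q ∈ D) (i : Fin 4) :
    pdx (r.frameTuple i) q = ∑ j, frameX A B r.a r.b i j q • r.frameTuple j q := by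
  obtain ⟨f0, f1, f2, f3⟩ := frameX_sum (A := A) (B := B) (a := r.a) (b := r.b) q
    (fun j => r.frameTuple j q)
  have a0 := (r.a_pos hq).ne'
  fin_cases i
  · exact f0.symm
  · refine Eq.trans ?_ f1.symm
    change pdx (pdx r.X) q = _
    rw [r.frame_combination (hne q hq) hq (pdx (pdx r.X) q), r.inner_pdx_pdx_pdx hD hq,
      r.inner_pdy_pdx_pdx hD hA hB hne hq, r.inner_N_pdx_pdx hD (hne q hq) hq]
    congr 3
    · field_simp
    · ring
  · refine Eq.trans ?_ f2.symm
    change pdx (pdy r.X) q = _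
    rw [pdx_pdy_comm hD r.smooth_X hq, r.pdy_pdx_X hD hA hB hne hq, neg_smul, neg_add_eq_sub]
    rfl
  · refine Eq.trans ?_ f3.symm
    change pdx r.N q = _
    rw [r.pdx_N hD (hne q hq) hq, neg_smul]
    rfl

theorem pdy_frameTuple (hq : q ∈ D) (i : Fin 4) :
    pdy (r.frameTuple i) q = ∑ j, frameY A B r.a r.b i j q • r.frameTuple j q := by
  obtain ⟨f0, f1, f2, f3⟩ := frameY_sum (A := A) (B := B) (a := r.a) (b := r.b) q
    (fun j => r.frameTuple j q)
  have b0 := (r.b_pos hq).ne'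
  fin_cases i
  · exact f0.symm
  · refine Eq.trans ?_ f1.symm
    change pdy (pdx r.X) q = _
    rw [r.pdy_pdx_X hD hA hB hne hq, neg_smul, neg_add_eq_sub]
    rfl
  · refine Eq.trans ?_ f2.symm
    change pdy (pdy r.X) q = _
    rw [r.frame_combination (hne q hq) hq (pdy (pdy r.X) q), r.inner_pdx_pdy_pdy hD hA hB hne hq,
      r.inner_pdy_pdy_pdy hD hq, r.inner_N_pdy_pdy hD (hne q hq) hq]
    congr 3
    · ring
    · field_simp
  · refine Eq.trans ?_ f3.symm
    change pdy r.N q = _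
    rw [r.pdy_N hD (hne q hq) hq, neg_smul]
    rfl

end Congruence

section Rectangle

variable {I J : Set ℝ} {A B : ℝ × ℝ → ℝ}

/-- Realizations with the same first fundamental form are congruent. -/
theorem congruent_of_a_eq_b_eq (hI : IsOpen I) [I.OrdConnected] (hJ : IsOpen J) [J.OrdConnected]
    (hA : ContDiffOn ℝ ∞ A (I ×ˢ J)) (hB : ContDiffOn ℝ ∞ B (I ×ˢ J))
    (hne : ∀ q ∈ I ×ˢ J, A q ≠ B q) {q₀ : ℝ × ℝ} (hq₀ : q₀ ∈ I ×ˢ J)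
    {r s : Realization (I ×ˢ J) A B} (h : ∀ q ∈ I ×ˢ J, r.a q = s.a q ∧ r.b q = s.b q) :
    Congruent r s := by
  have hD : IsOpen (I ×ˢ J) := hI.prod hJ
  have gram : ∀ t : Realization (I ×ˢ J) A B, ∀ i j,
      inner ℝ (![pdx t.X q₀, pdy t.X q₀, t.N q₀] i) (![pdx t.X q₀, pdy t.X q₀, t.N q₀] j)
        = if i = j then (![t.a q₀, t.b q₀, 1] i)⁻¹ else 0 := fun t =>
    gram_of_orthogonal (t.inner_pdx_pdx q₀) (t.inner_pdy_pdy q₀) (t.inner_N_N hq₀)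
      (t.inner_pdx_pdy (hne _ hq₀) hq₀) (t.inner_N_pdx hq₀) (t.inner_N_pdy hq₀)
  have gs := gram s
  rw [← (h q₀ hq₀).1, ← (h q₀ hq₀).2] at gs
  have hc : ∀ i, ![r.a q₀, r.b q₀, 1] i ≠ 0 := by
    intro i
    fin_cases i <;> simp [(r.a_pos hq₀).ne', (r.b_pos hq₀).ne']
  obtain ⟨L, hL⟩ := exists_linearIsometryEquiv_of_gram_eq hc (gram r) gs
  set c : E3 := s.X q₀ - L (r.X q₀) with hcdef
  -- The translation affects X only. The first column of each coefficient matrix is zero, so adding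
  -- C preserves solutions, and Z, the difference of two solutions, vanishes at q₀.
  let C : Fin 4 → E3 := ![c, 0, 0, 0]
  let Z : Fin 4 → ℝ × ℝ → E3 := fun i q => s.frameTuple i q - (L (r.frameTuple i q) + C i)
  have hLd : ∀ i, ∀ q ∈ I ×ˢ J, DifferentiableAt ℝ (fun q => L (r.frameTuple i q)) q :=
    fun i q hq => L.toContinuousLinearEquiv.differentiableAt.comp q
      (differentiableAt_of_smooth hD (r.smooth_frameTuple hD i) hq)
  have hsd : ∀ i, ∀ q ∈ I ×ˢ J, DifferentiableAt ℝ (s.frameTuple i) q :=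
    fun i q hq => differentiableAt_of_smooth hD (s.smooth_frameTuple hD i) hq
  have sumC : ∀ f : Fin 4 → ℝ, f 0 = 0 → ∑ j, f j • C j = 0 := fun f hf => by
    simp [Fin.sum_univ_four, C, hf]
  have hsum : ∀ f : Fin 4 → ℝ, f 0 = 0 → ∀ q, ∑ j, f j • Z j q
      = ∑ j, f j • s.frameTuple j q - L (∑ j, f j • r.frameTuple j q) := fun f hf q => by
    simp only [Z, smul_sub, smul_add, Finset.sum_sub_distrib, Finset.sum_add_distrib, sumC f hf,
      map_sum, map_smul, add_zero]
  have hzero : ∀ q ∈ I ×ˢ J, ∀ i, Z i q = 0 := by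
    have ha := r.smooth_a hD
    have hb := r.smooth_b hD
    refine tuple_eq_zero hI hJ
      (contDiffOn_frameX hD hA hB (fun q hq => sub_ne_zero.2 (hne q hq)) ha hb
        fun q hq => (r.a_pos hq).ne')
      (contDiffOn_frameY hD hA hB (fun q hq => sub_ne_zero.2 (hne q hq)) ha hb
        fun q hq => (r.b_pos hq).ne')
      (fun i q hq => (hsd i q hq).fun_sub ((hLd i q hq).add_const _)) (fun i q hq => ?_)
      (fun i q hq => ?_) hq₀ (fun i => ?_)
    · rw [hsum (fun j => frameX A B r.a r.b i j q) (by fin_cases i <;> rfl) q,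
        ← r.pdx_frameTuple hD hA hB hne hq i]
      have e : ∀ j, frameX A B r.a r.b i j q = frameX A B s.a s.b i j q := fun j => by
        have e1 := pdx_congr hD (fun p hp => (h p hp).1) hq
        fin_cases i <;> fin_cases j <;>
          simp [frameX, framePatternX, (h q hq).1, (h q hq).2, e1]
      simp only [e]
      rw [← s.pdx_frameTuple hD hA hB hne hq i, pdx_sub (hsd i q hq) ((hLd i q hq).add_const _),
        pdx_add (hLd i q hq) (differentiableAt_const _), pdx_const, add_zero]
      exact congrArg _ (pdx_clm L.toContinuousLinearEquiv.toContinuousLinearMap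
        (differentiableAt_of_smooth hD (r.smooth_frameTuple hD i) hq))
    · rw [hsum (fun j => frameY A B r.a r.b i j q) (by fin_cases i <;> rfl) q,
        ← r.pdy_frameTuple hD hA hB hne hq i]
      have e : ∀ j, frameY A B r.a r.b i j q = frameY A B s.a s.b i j q := fun j => by
        have e1 := pdy_congr hD (fun p hp => (h p hp).2) hq
        fin_cases i <;> fin_cases j <;>
          simp [frameY, framePatternY, (h q hq).1, (h q hq).2, e1]
      simp only [e]
      rw [← s.pdy_frameTuple hD hA hB hne hq i, pdy_sub (hsd i q hq) ((hLd i q hq).add_const _),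
        pdy_add (hLd i q hq) (differentiableAt_const _), pdy_const, add_zero]
      exact congrArg _ (pdy_clm L.toContinuousLinearEquiv.toContinuousLinearMap
        (differentiableAt_of_smooth hD (r.smooth_frameTuple hD i) hq))
    · have h0 : L (pdx r.X q₀) = pdx s.X q₀ := hL 0
      have h1 : L (pdy r.X q₀) = pdy s.X q₀ := hL 1
      have h2 : L (r.N q₀) = s.N q₀ := hL 2
      fin_cases i <;> simp [Z, C, frameTuple, h0, h1, h2, hcdef]
  refine ⟨L.toAffineIsometryEquiv.trans (AffineIsometryEquiv.constVAdd ℝ E3 c), fun q hq =>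
    ⟨?_, ?_⟩⟩
  · have := sub_eq_zero.1 (hzero q hq 0)
    refine this.trans ?_
    change L (r.X q) + c = c + L (r.X q)
    rw [add_comm]
  · have := sub_eq_zero.1 (hzero q hq 3)
    refine this.trans ?_
    change L (r.N q) + 0 = L (r.N q)
    rw [add_zero]

theorem toClass_eq_iff (hI : IsOpen I) [I.OrdConnected] (hJ : IsOpen J) [J.OrdConnected]
    (hA : ContDiffOn ℝ ∞ A (I ×ˢ J)) (hB : ContDiffOn ℝ ∞ B (I ×ˢ J))
    (hne : ∀ q ∈ I ×ˢ J, A q ≠ B q) {q₀ : ℝ × ℝ} (hq₀ : q₀ ∈ I ×ˢ J)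
    {r s : Realization (I ×ˢ J) A B} :
    r.toClass = s.toClass ↔ ∀ q ∈ I ×ˢ J, r.a q = s.a q ∧ r.b q = s.b q :=
  ⟨fun h _ hq => Congruent.a_eq_and_b_eq (hI.prod hJ) (Quotient.exact h) hq,
    fun h => Quotient.sound (congruent_of_a_eq_b_eq hI hJ hA hB hne hq₀ h)⟩

theorem toClass_surjective {D : Set (ℝ × ℝ)} (c : CongruenceClass D A B) :
    ∃ r : Realization D A B, r.toClass = c :=
  Quotient.exists_rep c

end Rectangle

end Realization

/-! ### Solutions of the total system: affine structure, determination at a point, realizability. -/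

namespace IsTotalSolution

section Pointwise

variable {D : Set (ℝ × ℝ)} {A B a b p a₁ b₁ p₁ : ℝ × ℝ → ℝ}

/-- The equation for a_x solved for p. Equating the result with that of `p_eq_of_b` recovers Gauss's
equation. -/
theorem p_eq_of_a (h : IsTotalSolution D A B a b p) (hBx : ∀ q ∈ D, pdx B q ≠ 0) {q : ℝ × ℝ}
    (hq : q ∈ D) : p q = pdx B q * pdx a q
      + 2 * (pdx (pdx B) q + pdx B q * (2 * pdx B q - pdx A q) / (A q - B q)) * a q
      - A q * B q * (B q - A q) := by
  have h0 := hBx q hq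
  rw [h.eq_a_x q hq, mul_div_assoc (pdx B q)]
  -- The quotient cancels as a whole, so A ≠ B is not required.
  generalize (2 * pdx B q - pdx A q) / (A q - B q) = k
  field_simp
  ring

theorem p_eq_of_b (h : IsTotalSolution D A B a b p) (hAy : ∀ q ∈ D, pdy A q ≠ 0) {q : ℝ × ℝ}
    (hq : q ∈ D) : p q = pdy A q * pdy b q
      + 2 * (pdy (pdy A) q + pdy A q * (2 * pdy A q - pdy B q) / (B q - A q)) * b q
      - A q * B q * (A q - B q) := by
  have h0 := hAy q hq
  rw [h.eq_b_y q hq, mul_div_assoc (pdy A q)]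
  generalize (2 * pdy A q - pdy B q) / (B q - A q) = k
  field_simp
  ring

/-- Affine combinations of solutions are solutions. -/
theorem affine_combination (hD : IsOpen D) (h : IsTotalSolution D A B a b p)
    (h₁ : IsTotalSolution D A B a₁ b₁ p₁) (t : ℝ) :
    IsTotalSolution D A B (fun q => (1 - t) * a q + t * a₁ q) (fun q => (1 - t) * b q + t * b₁ q)
      (fun q => (1 - t) * p q + t * p₁ q) := by
  have smooth : ∀ {f g : ℝ × ℝ → ℝ}, ContDiffOn ℝ ∞ f D → ContDiffOn ℝ ∞ g D →
      ContDiffOn ℝ ∞ (fun q => (1 - t) * f q + t * g q) D := fun hf hg =>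
    (contDiffOn_const.mul hf).add (contDiffOn_const.mul hg)
  have dx : ∀ {f g : ℝ × ℝ → ℝ}, ContDiffOn ℝ ∞ f D → ContDiffOn ℝ ∞ g D → ∀ q ∈ D,
      pdx (fun q => (1 - t) * f q + t * g q) q = (1 - t) * pdx f q + t * pdx g q := by
    intro f g hf hg q hq
    have hf := differentiableAt_of_smooth hD hf hq
    have hg := differentiableAt_of_smooth hD hg hq
    rw [pdx_add (hf.const_mul _) (hg.const_mul _), pdx_mul (differentiableAt_const _) hf,
      pdx_mul (differentiableAt_const _) hg, pdx_const, pdx_const]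
    ring
  have dy : ∀ {f g : ℝ × ℝ → ℝ}, ContDiffOn ℝ ∞ f D → ContDiffOn ℝ ∞ g D → ∀ q ∈ D,
      pdy (fun q => (1 - t) * f q + t * g q) q = (1 - t) * pdy f q + t * pdy g q := by
    intro f g hf hg q hq
    have hf := differentiableAt_of_smooth hD hf hq
    have hg := differentiableAt_of_smooth hD hg hq
    rw [pdy_add (hf.const_mul _) (hg.const_mul _), pdy_mul (differentiableAt_const _) hf,
      pdy_mul (differentiableAt_const _) hg, pdy_const, pdy_const]
    ring
  refine ⟨smooth h.smooth_a h₁.smooth_a, smooth h.smooth_b h₁.smooth_b,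
    smooth h.smooth_p h₁.smooth_p, fun q hq => ?_, fun q hq => ?_, fun q hq => ?_,
    fun q hq => ?_, fun q hq => ?_, fun q hq => ?_⟩
  · rw [dy h.smooth_a h₁.smooth_a q hq]
    linear_combination (1 - t) * h.eq_a_y q hq + t * h₁.eq_a_y q hq
  · rw [dx h.smooth_b h₁.smooth_b q hq]
    linear_combination (1 - t) * h.eq_b_x q hq + t * h₁.eq_b_x q hq
  · rw [dx h.smooth_a h₁.smooth_a q hq]
    linear_combination (1 - t) * h.eq_a_x q hq + t * h₁.eq_a_x q hq
  · rw [dy h.smooth_b h₁.smooth_b q hq]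
    linear_combination (1 - t) * h.eq_b_y q hq + t * h₁.eq_b_y q hq
  · rw [dy h.smooth_p h₁.smooth_p q hq]
    linear_combination (1 - t) * h.eq_p_y q hq + t * h₁.eq_p_y q hq
  · rw [dx h.smooth_p h₁.smooth_p q hq]
    linear_combination (1 - t) * h.eq_p_x q hq + t * h₁.eq_p_x q hq

end Pointwise

section Rectangle

variable {I J : Set ℝ} {A B a b p a₁ b₁ p₁ : ℝ × ℝ → ℝ}

/-- A solution of the total system is determined by its value at one point. -/
theorem eq_of_eq_at (hI : IsOpen I) [I.OrdConnected] (hJ : IsOpen J) [J.OrdConnected]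
    (hA : ContDiffOn ℝ ∞ A (I ×ˢ J)) (hB : ContDiffOn ℝ ∞ B (I ×ˢ J))
    (hne : ∀ q ∈ I ×ˢ J, A q ≠ B q) (hAy : ∀ q ∈ I ×ˢ J, pdy A q ≠ 0)
    (hBx : ∀ q ∈ I ×ˢ J, pdx B q ≠ 0) (h : IsTotalSolution (I ×ˢ J) A B a b p)
    (h₁ : IsTotalSolution (I ×ˢ J) A B a₁ b₁ p₁) {q₀ : ℝ × ℝ} (hq₀ : q₀ ∈ I ×ˢ J)
    (ha : a q₀ = a₁ q₀) (hb : b q₀ = b₁ q₀) (hp : p q₀ = p₁ q₀) {q : ℝ × ℝ} (hq : q ∈ I ×ˢ J) :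
    a q = a₁ q ∧ b q = b₁ q ∧ p q = p₁ q := by
  have hD : IsOpen (I ×ˢ J) := hI.prod hJ
  have hs : ∀ q ∈ I ×ˢ J, A q - B q ≠ 0 := fun q hq => sub_ne_zero.2 (hne q hq)
  have hs' : ∀ q ∈ I ×ˢ J, B q - A q ≠ 0 := fun q hq => sub_ne_zero.2 (hne q hq).symm
  have hs2 : ∀ q ∈ I ×ˢ J, (A q - B q) ^ 2 ≠ 0 := fun q hq => pow_ne_zero 2 (hs q hq)
  have hs2' : ∀ q ∈ I ×ˢ J, (B q - A q) ^ 2 ≠ 0 := fun q hq => pow_ne_zero 2 (hs' q hq)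
  have sAx := contDiffOn_pdx hD hA
  have sAy := contDiffOn_pdy hD hA
  have sAyy := contDiffOn_pdy hD sAy
  have sAyx := contDiffOn_pdx hD sAy
  have sAyyx := contDiffOn_pdx hD sAyy
  have sBx := contDiffOn_pdx hD hB
  have sBy := contDiffOn_pdy hD hB
  have sBxx := contDiffOn_pdx hD sBx
  have sBxy := contDiffOn_pdy hD sBx
  have sBxxy := contDiffOn_pdy hD sBxx
  have sAB := hA.sub hB
  have sBA := hB.sub hA
  have c2 : ContDiffOn ℝ ∞ (fun _ : ℝ × ℝ => (2 : ℝ)) (I ×ˢ J) := contDiffOn_const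
  have c1 : ContDiffOn ℝ ∞ (fun _ : ℝ × ℝ => (1 : ℝ)) (I ×ˢ J) := contDiffOn_const
  have c0 : ContDiffOn ℝ ∞ (0 : ℝ × ℝ → ℝ) (I ×ˢ J) := contDiffOn_const
  -- The homogeneous part of the total system: P and Q act on the differences in the order a, b, p,
  -- where the inhomogeneous terms have cancelled.
  let P : Fin 3 → Fin 3 → ℝ × ℝ → ℝ :=
    ![![fun q => -(2 * (pdx (pdx B) q / pdx B q + (2 * pdx B q - pdx A q) / (A q - B q))), 0,
        fun q => 1 / pdx B q],
      ![0, fun q => 2 * pdx B q / (B q - A q), 0],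
      ![0, fun q => 2 * (pdx (pdy (pdy A)) q - pdy (pdy A) q * pdx (pdy A) q / pdy A q
        + 2 * pdy A q * pdx (pdy A) q / (B q - A q)
        - pdy A q * (pdx B q * pdy A q + pdy B q * pdx A q - 2 * pdy A q * pdx A q)
          / (B q - A q) ^ 2),
        fun q => pdx (pdy A) q / pdy A q + 2 * pdx B q / (B q - A q)]]
  let Q : Fin 3 → Fin 3 → ℝ × ℝ → ℝ :=
    ![![fun q => 2 * pdy A q / (A q - B q), 0, 0],
      ![0, fun q => -(2 * (pdy (pdy A) q / pdy A q + (2 * pdy A q - pdy B q) / (B q - A q))),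
        fun q => 1 / pdy A q],
      ![fun q => 2 * (pdy (pdx (pdx B)) q - pdx (pdx B) q * pdy (pdx B) q / pdx B q
        + 2 * pdx B q * pdy (pdx B) q / (A q - B q)
        - pdx B q * (pdy A q * pdx B q + pdx A q * pdy B q - 2 * pdx B q * pdy B q)
          / (A q - B q) ^ 2), 0,
        fun q => pdy (pdx B) q / pdx B q + 2 * pdy A q / (A q - B q)]]
  have hP : ∀ i j, ContDiffOn ℝ ∞ (P i j) (I ×ˢ J) := by
    have k1 := (c2.mul ((sBxx.div sBx hBx).add (((c2.mul sBx).sub sAx).div sAB hs))).neg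
    have k2 := c1.div sBx hBx
    have k3 := (c2.mul sBx).div sBA hs'
    have k4 := c2.mul (((sAyyx.sub ((sAyy.mul sAyx).div sAy hAy)).add
      (((c2.mul sAy).mul sAyx).div sBA hs')).sub ((sAy.mul
        (((sBx.mul sAy).add (sBy.mul sAx)).sub ((c2.mul sAy).mul sAx))).div (sBA.pow 2) hs2'))
    have k5 := (sAyx.div sAy hAy).add k3
    intro i j
    fin_cases i <;> fin_cases j <;>
      first | exact c0 | exact k1 | exact k2 | exact k3 | exact k4 | exact k5
  have hQ : ∀ i j, ContDiffOn ℝ ∞ (Q i j) (I ×ˢ J) := by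
    have k1 := (c2.mul ((sAyy.div sAy hAy).add (((c2.mul sAy).sub sBy).div sBA hs'))).neg
    have k2 := c1.div sAy hAy
    have k3 := (c2.mul sAy).div sAB hs
    have k4 := c2.mul (((sBxxy.sub ((sBxx.mul sBxy).div sBx hBx)).add
      (((c2.mul sBx).mul sBxy).div sAB hs)).sub ((sBx.mul
        (((sAy.mul sBx).add (sAx.mul sBy)).sub ((c2.mul sBx).mul sBy))).div (sAB.pow 2) hs2))
    have k5 := (sBxy.div sBx hBx).add k3
    intro i j
    fin_cases i <;> fin_cases j <;>
      first | exact c0 | exact k1 | exact k2 | exact k3 | exact k4 | exact k5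
  let Y : Fin 3 → ℝ × ℝ → ℝ := ![fun q => a q - a₁ q, fun q => b q - b₁ q, fun q => p q - p₁ q]
  have d : ∀ {f : ℝ × ℝ → ℝ}, ContDiffOn ℝ ∞ f (I ×ˢ J) → ∀ q ∈ I ×ˢ J, DifferentiableAt ℝ f q :=
    fun hf q hq => differentiableAt_of_smooth hD hf hq
  have hY : ∀ i, ∀ q ∈ I ×ˢ J, DifferentiableAt ℝ (Y i) q := by
    intro i q hq
    fin_cases i
    · exact (d h.smooth_a q hq).sub (d h₁.smooth_a q hq)
    · exact (d h.smooth_b q hq).sub (d h₁.smooth_b q hq)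
    · exact (d h.smooth_p q hq).sub (d h₁.smooth_p q hq)
  have hYx : ∀ i, ∀ q ∈ I ×ˢ J, pdx (Y i) q = ∑ j, P i j q • Y j q := by
    intro i q hq
    rw [Fin.sum_univ_three]
    fin_cases i
    · refine (pdx_sub (d h.smooth_a q hq) (d h₁.smooth_a q hq)).trans ?_
      simp [P, Y]
      linear_combination h.eq_a_x q hq - h₁.eq_a_x q hq
    · refine (pdx_sub (d h.smooth_b q hq) (d h₁.smooth_b q hq)).trans ?_
      simp [P, Y]
      linear_combination h.eq_b_x q hq - h₁.eq_b_x q hq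
    · refine (pdx_sub (d h.smooth_p q hq) (d h₁.smooth_p q hq)).trans ?_
      simp [P, Y]
      linear_combination h.eq_p_x q hq - h₁.eq_p_x q hq
  have hYy : ∀ i, ∀ q ∈ I ×ˢ J, pdy (Y i) q = ∑ j, Q i j q • Y j q := by
    intro i q hq
    rw [Fin.sum_univ_three]
    fin_cases i
    · refine (pdy_sub (d h.smooth_a q hq) (d h₁.smooth_a q hq)).trans ?_
      simp [Q, Y]
      linear_combination h.eq_a_y q hq - h₁.eq_a_y q hq
    · refine (pdy_sub (d h.smooth_b q hq) (d h₁.smooth_b q hq)).trans ?_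
      simp [Q, Y]
      linear_combination h.eq_b_y q hq - h₁.eq_b_y q hq
    · refine (pdy_sub (d h.smooth_p q hq) (d h₁.smooth_p q hq)).trans ?_
      simp [Q, Y]
      linear_combination h.eq_p_y q hq - h₁.eq_p_y q hq
  have key := tuple_eq_zero hI hJ hP hQ hY hYx hYy hq₀
    (fun i => by fin_cases i <;> simp [Y, ha, hb, hp]) q hq
  exact ⟨sub_eq_zero.1 (key 0), sub_eq_zero.1 (key 1), sub_eq_zero.1 (key 2)⟩

/-- A positive solution of the total system comes from a realization. -/
theorem exists_realization (hI : IsOpen I) [I.OrdConnected] (hJ : IsOpen J) [J.OrdConnected]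
    (hA : ContDiffOn ℝ ∞ A (I ×ˢ J)) (hB : ContDiffOn ℝ ∞ B (I ×ˢ J))
    (hne : ∀ q ∈ I ×ˢ J, A q ≠ B q) (hAy : ∀ q ∈ I ×ˢ J, pdy A q ≠ 0)
    (hBx : ∀ q ∈ I ×ˢ J, pdx B q ≠ 0) (h : IsTotalSolution (I ×ˢ J) A B a b p)
    (hpos : ∀ q ∈ I ×ˢ J, 0 < a q ∧ 0 < b q) {q₀ : ℝ × ℝ} (hq₀ : q₀ ∈ I ×ˢ J) :
    ∃ r : Realization (I ×ˢ J) A B, ∀ q ∈ I ×ˢ J, r.a q = a q ∧ r.b q = b q ∧ r.p q = p q := by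
  obtain ⟨r, hr⟩ := ShapeOperator.exists_realization hI hJ hA hB hne h.smooth_a h.smooth_b
    (fun q hq => (hpos q hq).1) (fun q hq => (hpos q hq).2) h.eq_a_y h.eq_b_x
    (fun q hq => (h.p_eq_of_a hBx hq).symm.trans (h.p_eq_of_b hAy hq)) hq₀
  refine ⟨r, fun q hq => ⟨(hr q hq).1, (hr q hq).2, ?_⟩⟩
  rw [h.p_eq_of_a hBx hq, Realization.p, (hr q hq).1,
    pdx_congr (hI.prod hJ) (fun q hq => (hr q hq).1) hq]

end Rectangle

end IsTotalSolution

/-! ### Convex combinations of realizations. -/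

/-- Any two realizations are joined by realizations whose functions `(a, b, p)` are the affine
interpolations. -/
theorem Realization.exists_interpolation {I J : Set ℝ} {A B : ℝ × ℝ → ℝ} (hI : IsOpen I)
    [I.OrdConnected] (hJ : IsOpen J) [J.OrdConnected]
    (hA : ContDiffOn ℝ ∞ A (I ×ˢ J)) (hB : ContDiffOn ℝ ∞ B (I ×ˢ J))
    (hne : ∀ q ∈ I ×ˢ J, A q ≠ B q) (hAy : ∀ q ∈ I ×ˢ J, pdy A q ≠ 0)
    (hBx : ∀ q ∈ I ×ˢ J, pdx B q ≠ 0) {q₀ : ℝ × ℝ} (hq₀ : q₀ ∈ I ×ˢ J)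
    (r s : Realization (I ×ˢ J) A B) {t : ℝ} (ht : t ∈ Icc (0 : ℝ) 1) :
    ∃ u : Realization (I ×ˢ J) A B, ∀ q ∈ I ×ˢ J, u.a q = (1 - t) * r.a q + t * s.a q ∧
      u.b q = (1 - t) * r.b q + t * s.b q ∧ u.p q = (1 - t) * r.p q + t * s.p q := by
  have hD : IsOpen (I ×ˢ J) := hI.prod hJ
  have pos : ∀ x y : ℝ, 0 < x → 0 < y → 0 < (1 - t) * x + t * y := by
    intro x y hx hy
    -- At t = 0 the y-term vanishes and strictness comes from x; for t > 0 it comes from y.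
    rcases ht.1.eq_or_lt with rfl | h
    · simpa using hx
    · have := mul_pos h hy
      have := mul_nonneg (sub_nonneg.2 ht.2) hx.le
      linarith
  exact ((r.isTotalSolution hD hA hB hne hAy hBx).affine_combination hD
    (s.isTotalSolution hD hA hB hne hAy hBx) t).exists_realization hI hJ hA hB hne hAy hBx
    (fun q hq => ⟨pos _ _ (r.a_pos hq) (s.a_pos hq), pos _ _ (r.b_pos hq) (s.b_pos hq)⟩) hq₀

theorem convex_of_forall_exists {E : Type*} [AddCommGroup E] [Module ℝ E] {S : Set E}
    (h : ∀ x ∈ S, ∀ y ∈ S, ∀ t ∈ Icc (0 : ℝ) 1, (1 - t) • x + t • y ∈ S) : Convex ℝ S := by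
  intro x hx y hy s t hs ht hst
  obtain rfl : s = 1 - t := by linarith
  exact h x hx y hy t ⟨ht, by linarith⟩

end ShapeOperator

/-! ### Assembly of the main theorem. -/

theorem theorem1 (I J : Set ℝ)
    (hI : IsOpen I) (hI_conn : I.OrdConnected) (hI_ne : I.Nonempty)
    (hJ : IsOpen J) (hJ_conn : J.OrdConnected) (hJ_ne : J.Nonempty)
    (A B : ℝ × ℝ → ℝ)
    (hA : ContDiffOn ℝ ∞ A (I ×ˢ J)) (hB : ContDiffOn ℝ ∞ B (I ×ˢ J))
    (hAB : ∀ q ∈ I ×ˢ J, B q < A q)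
    (hAy : ∀ q ∈ I ×ˢ J, pdy A q ≠ 0)
    (hBx : ∀ q ∈ I ×ˢ J, pdx B q ≠ 0) :
    -- the classes are the positive solutions of the total system, through `I = dx² / a + dy² / b`
    (∃ Ψ : CongruenceClass (I ×ˢ J) A B →
          ((I ×ˢ J : Set (ℝ × ℝ)) → ℝ) × ((I ×ˢ J : Set (ℝ × ℝ)) → ℝ),
      (∀ r : Realization (I ×ˢ J) A B,
        Ψ r.toClass = ((I ×ˢ J).domRestrict r.a, (I ×ˢ J).domRestrict r.b)) ∧
      Function.Injective Ψ ∧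
      Set.range Ψ =
        {u | ∃ a b p : ℝ × ℝ → ℝ, IsTotalSolution (I ×ˢ J) A B a b p ∧
          (∀ q ∈ I ×ˢ J, 0 < a q ∧ 0 < b q) ∧ u = ((I ×ˢ J).domRestrict a, (I ×ˢ J).domRestrict b)} ∧
      Convex ℝ (Set.range Ψ) ∧
      -- the value of `(a, b, p)` at any one point embeds the classes affinely as a convex set in
      -- a vector space of dimension 3
      ∀ q₀ ∈ I ×ˢ J, ∃ Φ : CongruenceClass (I ×ˢ J) A B → (Fin 3 → ℝ),
        (∀ r : Realization (I ×ˢ J) A B, Φ r.toClass = ![r.a q₀, r.b q₀, r.p q₀]) ∧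
        Function.Injective Φ ∧
        Convex ℝ (Set.range Φ) ∧
        ∀ c₀ c₁ : CongruenceClass (I ×ˢ J) A B, ∀ t ∈ Set.Icc (0 : ℝ) 1,
          ∃ c : CongruenceClass (I ×ˢ J) A B,
            Ψ c = (1 - t) • Ψ c₀ + t • Ψ c₁ ∧ Φ c = (1 - t) • Φ c₀ + t • Φ c₁) ∧
    -- every realization gives a solution of the total system
    (∀ r : Realization (I ×ˢ J) A B, IsTotalSolution (I ×ˢ J) A B r.a r.b r.p) ∧
    -- a solution of the total system is determined by its value at one point
    (∀ a b p a₁ b₁ p₁ : ℝ × ℝ → ℝ,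
      IsTotalSolution (I ×ˢ J) A B a b p → IsTotalSolution (I ×ˢ J) A B a₁ b₁ p₁ →
      ∀ q₀ ∈ I ×ˢ J, a q₀ = a₁ q₀ → b q₀ = b₁ q₀ → p q₀ = p₁ q₀ →
        ∀ q ∈ I ×ˢ J, a q = a₁ q ∧ b q = b₁ q ∧ p q = p₁ q) := by
  have : I.OrdConnected := hI_conn
  have : J.OrdConnected := hJ_conn
  have hD : IsOpen (I ×ˢ J) := hI.prod hJ
  have hne : ∀ q ∈ I ×ˢ J, A q ≠ B q := fun q hq => (hAB q hq).ne'
  obtain ⟨x₁, hx₁⟩ := hI_ne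
  obtain ⟨y₁, hy₁⟩ := hJ_ne
  have hq₁ : (x₁, y₁) ∈ I ×ˢ J := ⟨hx₁, hy₁⟩
  have total : ∀ r : Realization (I ×ˢ J) A B, IsTotalSolution (I ×ˢ J) A B r.a r.b r.p :=
    fun r => r.isTotalSolution hD hA hB hne hAy hBx
  have classEq : ∀ r s : Realization (I ×ˢ J) A B,
      r.toClass = s.toClass ↔ ∀ q ∈ I ×ˢ J, r.a q = s.a q ∧ r.b q = s.b q :=
    fun r s => Realization.toClass_eq_iff hI hJ hA hB hne hq₁
  have interp := fun (r s : Realization (I ×ˢ J) A B) (t : ℝ) (ht : t ∈ Set.Icc (0 : ℝ) 1) =>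
    Realization.exists_interpolation hI hJ hA hB hne hAy hBx hq₁ r s ht
  -- Restriction to D is essential: congruent realizations may differ off D.
  let Ψ : CongruenceClass (I ×ˢ J) A B →
      ((I ×ˢ J : Set (ℝ × ℝ)) → ℝ) × ((I ×ˢ J : Set (ℝ × ℝ)) → ℝ) :=
    Quotient.lift (fun r => ((I ×ˢ J).domRestrict r.a, (I ×ˢ J).domRestrict r.b)) (by
      intro r s h
      have h' := (classEq r s).1 (Quotient.sound h)
      exact Prod.ext (funext fun q => (h' q q.2).1) (funext fun q => (h' q q.2).2))
  have hΨ : ∀ r : Realization (I ×ˢ J) A B,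
      Ψ r.toClass = ((I ×ˢ J).domRestrict r.a, (I ×ˢ J).domRestrict r.b) := fun r => rfl
  have combΨ : ∀ (r s u : Realization (I ×ˢ J) A B) (t : ℝ), (∀ q ∈ I ×ˢ J,
      u.a q = (1 - t) * r.a q + t * s.a q ∧ u.b q = (1 - t) * r.b q + t * s.b q ∧
        u.p q = (1 - t) * r.p q + t * s.p q) →
      Ψ u.toClass = (1 - t) • Ψ r.toClass + t • Ψ s.toClass := fun r s u t h =>
    Prod.ext (funext fun q => (h q q.2).1) (funext fun q => (h q q.2).2.1)
  refine ⟨⟨Ψ, hΨ, ?_, ?_, ?_, ?_⟩, total, ?_⟩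
  · intro c d hcd
    obtain ⟨r, rfl⟩ := Realization.toClass_surjective c
    obtain ⟨s, rfl⟩ := Realization.toClass_surjective d
    rw [hΨ, hΨ, Prod.mk.injEq] at hcd
    exact (classEq r s).2 fun q hq => ⟨congrFun hcd.1 ⟨q, hq⟩, congrFun hcd.2 ⟨q, hq⟩⟩
  · ext u
    constructor
    · rintro ⟨c, rfl⟩
      obtain ⟨r, rfl⟩ := Realization.toClass_surjective c
      exact ⟨r.a, r.b, r.p, total r, fun q hq => ⟨r.a_pos hq, r.b_pos hq⟩, rfl⟩
    · rintro ⟨a, b, p, h, hpos, rfl⟩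
      obtain ⟨r, hr⟩ := h.exists_realization hI hJ hA hB hne hAy hBx hpos hq₁
      exact ⟨r.toClass, Prod.ext (funext fun q => (hr q q.2).1) (funext fun q => (hr q q.2).2.1)⟩
  · refine convex_of_forall_exists ?_
    rintro _ ⟨c, rfl⟩ _ ⟨d, rfl⟩ t ht
    obtain ⟨r, rfl⟩ := Realization.toClass_surjective c
    obtain ⟨s, rfl⟩ := Realization.toClass_surjective d
    obtain ⟨u, hu⟩ := interp r s t ht
    exact ⟨u.toClass, combΨ r s u t hu⟩
  · intro q₀ hq₀
    let Φ : CongruenceClass (I ×ˢ J) A B → (Fin 3 → ℝ) :=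
      Quotient.lift (fun r => ![r.a q₀, r.b q₀, r.p q₀]) (by
        intro r s h
        have h' := (classEq r s).1 (Quotient.sound h)
        rw [(h' q₀ hq₀).1, (h' q₀ hq₀).2,
          Realization.p_eq_of_a_eq hD (fun q hq => (h' q hq).1) hq₀])
    have hΦ : ∀ r : Realization (I ×ˢ J) A B, Φ r.toClass = ![r.a q₀, r.b q₀, r.p q₀] :=
      fun r => rfl
    have comb : ∀ c₀ c₁ : CongruenceClass (I ×ˢ J) A B, ∀ t ∈ Set.Icc (0 : ℝ) 1,
        ∃ c : CongruenceClass (I ×ˢ J) A B,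
          Ψ c = (1 - t) • Ψ c₀ + t • Ψ c₁ ∧ Φ c = (1 - t) • Φ c₀ + t • Φ c₁ := by
      intro c d t ht
      obtain ⟨r, rfl⟩ := Realization.toClass_surjective c
      obtain ⟨s, rfl⟩ := Realization.toClass_surjective d
      obtain ⟨u, hu⟩ := interp r s t ht
      refine ⟨u.toClass, combΨ r s u t hu, ?_⟩
      rw [hΦ, hΦ, hΦ, (hu q₀ hq₀).1, (hu q₀ hq₀).2.1, (hu q₀ hq₀).2.2]
      ext i
      fin_cases i <;> rfl
    refine ⟨Φ, hΦ, ?_, ?_, comb⟩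
    · intro c d hcd
      obtain ⟨r, rfl⟩ := Realization.toClass_surjective c
      obtain ⟨s, rfl⟩ := Realization.toClass_surjective d
      rw [hΦ, hΦ] at hcd
      refine (classEq r s).2 fun q hq => ?_
      -- Equal values of (a, b, p) at q₀ force equal (a, b) on all of D, hence congruence.
      have h := (total r).eq_of_eq_at hI hJ hA hB hne hAy hBx (total s) hq₀ (congrFun hcd 0)
        (congrFun hcd 1) (congrFun hcd 2) hq
      exact ⟨h.1, h.2.1⟩
    · refine convex_of_forall_exists ?_
      rintro _ ⟨c, rfl⟩ _ ⟨d, rfl⟩ t ht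
      obtain ⟨e, -, he⟩ := comb c d t ht
      exact ⟨e, he⟩
  · intro a b p a₁ b₁ p₁ h h₁ q₀ hq₀ ha hb hp q hq
    exact h.eq_of_eq_at hI hJ hA hB hne hAy hBx h₁ hq₀ ha hb hp hq
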